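/- Let $\mathcal{H}_S$ and $\mathcal{H}_A$ be complex separable Hilbert spaces and let $\mathcal{X}$ be a countable set. An \emph{observable} on $\mathcal{H}$ with value space $\mathcal{X}$ is a family $\mathsf{E}=\{\mathsf{E}(x)\}_{x\in\mathcal{X}}$ of positive bounded operators with $\sum_x \mathsf{E}(x)=\mathbb{1}$ (weakly). It is \emph{sharp} if $\mathsf{E}(x)\mathsf{E}(y)=\delta_{x,y}\mathsf{E}(x)$ for all $x,y$, and \emph{extremal} if it is an extreme point of the convex set of observables on $\mathcal{H}$ with value space $\mathcal{X}$. Let $\mathcal{M}=(\mathcal{H}_A,\xi,\mathcal{E},\mathsf{Z})$ be a measurement scheme: $\xi$ is a state (positive, trace class, unit trace) on $\mathcal{H}_A$; $\mathcal{E}$ is a channel, i.e. a completely positive trace-preserving linear map on the trace-class operators of $\mathcal{H}_S\otimes\mathcal{H}_A$, with dual $\mathcal{E}^*$ given by $\mathrm{tr}[\mathcal{E}^*(A)T]=\mathrm{tr}[A\,\mathcal{E}(T)]$; and $\mathsf{Z}=\{\mathsf{Z}(x)\}_{x\in\mathcal{X}}$ is an observable on $\mathcal{H}_A$. Let $\Gamma_\xi:\mathcal{L}(\mathcal{H}_S\otimes\mathcal{H}_A)\to\mathcal{L}(\mathcal{H}_S)$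 be the restriction map, given by $\mathrm{tr}[\Gamma_\xi(B)T]=\mathrm{tr}[B(T\otimes\xi)]$ for all trace-class $T$. Put $\mathsf{Z}^\tau(x):=\mathcal{E}^*(\mathbb{1}\otimes\mathsf{Z}(x))$; the observable measured by $\mathcal{M}$ is $x\mapsto\Gamma_\xi(\mathsf{Z}^\tau(x))$. For a target observable $\mathsf{E}=\{\mathsf{E}(x)\}_{x\in\mathcal{X}}$ on $\mathcal{H}_S$ let $\epsilon(x):=\Gamma_\xi(\mathsf{Z}^\tau(x))-\mathsf{E}(x)$; $\mathcal{M}$ is a measurement scheme for $\mathsf{E}$ if $\epsilon(x)=0$ for all $x$. Let $N_S$ and $N_A$ be bounded self-adjoint operators on $\mathcal{H}_S$ and $\mathcal{H}_A$, and $N:=N_S\otimes\mathbb{1}+\mathbb{1}\otimes N_A$. For a state $\rho$ on $\mathcal{H}_A$ let $\mathrm{Var}(N_A,\rho):=\mathrm{tr}[N_A^2\rho]-\mathrm{tr}[N_A\rho]^2$, and let the quantum Fisher information be $$\mathcal{Q}(N_A,\xi):=4\inf_{\{q_i,\phi_i\}}\sum_i q_i\,\mathrm{Var}(N_A,|\phi_i\rangle\langle\phi_i|),$$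 the infimum being over all countable ensembles of unit vectors $\phi_i\in\mathcal{H}_A$ and probabilities $q_i$ with $\xi=\sum_i q_i|\phi_i\rangle\langle\phi_i|$. \textbf{Proposition.} Assume the weak Yanase condition $[\mathsf{Z}^\tau(x),N]=0$ for all $x\in\mathcal{X}$. Then for all $x\in\mathcal{X}$ $$\|[\mathsf{E}(x),N_S]\|\le 2\|N_S\|\,\|\epsilon(x)\|+2\,\mathrm{Var}(N_A,\xi)^{1/2}\big(2\|\epsilon(x)\|+\|\mathsf{E}(x)-\mathsf{E}(x)^2\|\big)^{1/2}$$ and $$\|[\mathsf{E}(x),N_S]\|\le 2\|N_S\|\,\|\epsilon(x)\|+\tfrac12\,\mathcal{Q}(N_A,\xi)^{1/2}.$$ If moreover $\mathsf{E}$ is extremal and $\mathcal{M}$ is a measurement scheme for $\mathsf{E}$, then for all $x\in\mathcal{X}$ $$\|[\mathsf{E}(x),N_S]\|\le\mathcal{Q}(N_A,\xi)^{1/2}\,\|\mathsf{E}(x)-\mathsf{E}(x)^2\|^{1/2}.$$ In particular, if $\mathsf{E}$ is sharp and $\mathcal{M}$ is a measurement scheme for $\mathsf{E}$, then $[\mathsf{E}(x),N_S]=0$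 for all $x\in\mathcal{X}$. -/

import Mathlib

open scoped TensorProduct ComplexOrder

noncomputable section

namespace QuantumMeasurement

/-! ### Trace-class operators and the trace -/

section TraceClass

variable {H : Type*} [NormedAddCommGroup H] [InnerProductSpace ℂ H]

/-- `T` is trace class (nuclear): it is a sum `∑ₙ |aₙ⟩⟨bₙ|` of rank-one operators with
`∑ₙ ‖aₙ‖ ‖bₙ‖ < ∞`. -/
def IsTraceClass (T : H →L[ℂ] H) : Prop :=
  ∃ a b : ℕ → H, Summable (fun n => ‖a n‖ * ‖b n‖) ∧
    HasSum (fun n => InnerProductSpace.rankOne ℂ (a n) (b n)) T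

/-- Any countable index set may be used in place of `ℕ`. -/
theorem IsTraceClass.of_index {ι : Type*} [Countable ι] [Infinite ι] {T : H →L[ℂ] H}
    (a b : ι → H) (hs : Summable (fun n => ‖a n‖ * ‖b n‖))
    (hT : HasSum (fun n => InnerProductSpace.rankOne ℂ (a n) (b n)) T) : IsTraceClass T := by
  obtain ⟨e⟩ := nonempty_equiv_of_countable (α := ℕ) (β := ι)
  exact ⟨a ∘ e, b ∘ e, (e.summable_iff (f := fun n => ‖a n‖ * ‖b n‖)).2 hs,
    (e.hasSum_iff (f := fun n => InnerProductSpace.rankOne ℂ (a n) (b n))).2 hT⟩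

theorem IsTraceClass.zero : IsTraceClass (0 : H →L[ℂ] H) :=
  ⟨0, 0, by simp, by simp⟩

theorem IsTraceClass.add {S T : H →L[ℂ] H} (hS : IsTraceClass S) (hT : IsTraceClass T) :
    IsTraceClass (S + T) := by
  obtain ⟨a, b, h1, h2⟩ := hS
  obtain ⟨c, d, h3, h4⟩ := hT
  refine IsTraceClass.of_index (ι := ℕ ⊕ ℕ) (Sum.elim a c) (Sum.elim b d) ?_ ?_
  · exact (HasSum.sum (f := fun n => ‖Sum.elim a c n‖ * ‖Sum.elim b d n‖)
      (by simpa [Function.comp_def] using h1.hasSum)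
      (by simpa [Function.comp_def] using h3.hasSum)).summable
  · exact HasSum.sum
      (f := fun n => InnerProductSpace.rankOne ℂ (Sum.elim a c n) (Sum.elim b d n))
      (by simpa [Function.comp_def] using h2) (by simpa [Function.comp_def] using h4)

theorem IsTraceClass.smul (z : ℂ) {T : H →L[ℂ] H} (hT : IsTraceClass T) :
    IsTraceClass (z • T) := by
  obtain ⟨a, b, h1, h2⟩ := hT
  refine ⟨fun n => z • a n, b, ?_, ?_⟩
  · simpa [norm_smul, mul_assoc] using h1.mul_left ‖z‖
  · simpa using h2.const_smul z

variable (H) in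
/-- The space `𝒯(H)` of trace-class operators on `H`. -/
def traceClass : Submodule ℂ (H →L[ℂ] H) where
  carrier := {T | IsTraceClass T}
  zero_mem' := IsTraceClass.zero
  add_mem' := IsTraceClass.add
  smul_mem' z _ := IsTraceClass.smul z

variable [CompleteSpace H]

variable (H) in
/-- Index set of a chosen orthonormal basis of `H`. -/
def basisIndex : Set H := (exists_hilbertBasis ℂ H).choose

variable (H) in
/-- A chosen orthonormal basis of `H`. -/
def onb : HilbertBasis (basisIndex H) ℂ H := (exists_hilbertBasis ℂ H).choose_spec.choose

/-- The trace `∑ᵢ ⟨eᵢ, T eᵢ⟩` along an orthonormal basis; for trace-class `T` the series is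
absolutely convergent and its sum does not depend on the basis. -/
def trace (T : H →L[ℂ] H) : ℂ := ∑' i, inner ℂ (onb H i) (T (onb H i))

/-- States (density operators): positive trace-class operators of unit trace. -/
structure IsState (ρ : H →L[ℂ] H) : Prop where
  traceClass : IsTraceClass ρ
  positive : ρ.IsPositive
  trace_eq_one : trace ρ = 1

end TraceClass

/-! ### Channels and their duals -/

section Channel

variable {H K : Type*} [NormedAddCommGroup H] [InnerProductSpace ℂ H]
  [NormedAddCommGroup K] [InnerProductSpace ℂ K]

/-- Positivity of an `n × n` block matrix of operators on `H`, as an operator on `Hⁿ`. -/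
def IsPositiveMatrix {n : ℕ} (T : Fin n → Fin n → (H →L[ℂ] H)) : Prop :=
  ∀ ψ : Fin n → H, (0 : ℂ) ≤ ∑ i, ∑ j, inner ℂ (ψ i) (T i j (ψ j))

/-- Complete positivity of a linear map `𝒯(H) → 𝒯(K)`: for each `n` its entrywise action on
`n × n` matrices preserves positivity. -/
def IsCompletelyPositive (Φ : traceClass H →ₗ[ℂ] traceClass K) : Prop :=
  ∀ (n : ℕ) (T : Fin n → Fin n → traceClass H),
    IsPositiveMatrix (fun i j => (T i j : H →L[ℂ] H)) →
      IsPositiveMatrix (fun i j => (Φ (T i j) : K →L[ℂ] K))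

variable [CompleteSpace H] [CompleteSpace K]

/-- Channels (Schrödinger picture): completely positive trace-preserving linear maps. -/
structure IsChannel (Φ : traceClass H →ₗ[ℂ] traceClass K) : Prop where
  completelyPositive : IsCompletelyPositive Φ
  trace_preserving : ∀ T : traceClass H, trace (Φ T : K →L[ℂ] K) = trace (T : H →L[ℂ] H)

open Classical in
/-- The dual `Φ* : ℒ(K) → ℒ(H)` of `Φ`: `Φ*(A)` is the unique bounded operator with
`tr[Φ*(A) T] = tr[A Φ(T)]` for all trace-class `T`. It exists whenever `Φ` is bounded for the
trace norms, in particular when `Φ` is a channel; the value `0` otherwise is a mere convention. -/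
def dual (Φ : traceClass H →ₗ[ℂ] traceClass K) (A : K →L[ℂ] K) : H →L[ℂ] H :=
  if h : ∃ B : H →L[ℂ] H, ∀ T : traceClass H,
      trace (B * (T : H →L[ℂ] H)) = trace (A * (Φ T : K →L[ℂ] K))
  then h.choose else 0

end Channel

/-! ### Hilbert space tensor products -/

section Tensor

variable {H K : Type*} [NormedAddCommGroup H] [InnerProductSpace ℂ H]
  [NormedAddCommGroup K] [InnerProductSpace ℂ K]

variable (H K) in
/-- The Hilbert space tensor product: the completion of the algebraic tensor product for the
inner product `⟨a ⊗ b, c ⊗ d⟩ = ⟨a, c⟩⟨b, d⟩`. -/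
abbrev HilbertTensor : Type _ := UniformSpace.Completion (H ⊗[ℂ] K)

/-- The operator `A ⊗ B` on the Hilbert space tensor product. -/
def tensorOp (A : H →L[ℂ] H) (B : K →L[ℂ] K) : HilbertTensor H K →L[ℂ] HilbertTensor H K :=
  (TensorProduct.mapL A B).completion

/-- Elementary tensors. -/
def tensorVec (x : H) (y : K) : HilbertTensor H K := ((x ⊗ₜ[ℂ] y : H ⊗[ℂ] K) : HilbertTensor H K)

variable (H K) in
/-- `(x, y) ↦ x ⊗ y` as a continuous bilinear map. -/
def tensorVecL : H →L[ℂ] K →L[ℂ] HilbertTensor H K :=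
  (ContinuousLinearMap.compL ℂ K (H ⊗[ℂ] K) (HilbertTensor H K)
    UniformSpace.Completion.toComplL).comp (TensorProduct.mkL ℂ H K)

theorem tensorVecL_apply (x : H) (y : K) : tensorVecL H K x y = tensorVec x y := rfl

theorem tensorOp_tensorVec (A : H →L[ℂ] H) (B : K →L[ℂ] K) (x : H) (y : K) :
    tensorOp A B (tensorVec x y) = tensorVec (A x) (B y) := by
  simp [tensorOp, tensorVec]

theorem inner_tensorVec (x x' : H) (y y' : K) :
    inner ℂ (tensorVec x y) (tensorVec x' y') = inner ℂ x x' * inner ℂ y y' := by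
  simp [tensorVec]

theorem norm_tensorVec (x : H) (y : K) : ‖tensorVec x y‖ = ‖x‖ * ‖y‖ := by
  simp [tensorVec]

/-- Bounded operators that agree on elementary tensors are equal. -/
theorem ext_tensorVec {S T : HilbertTensor H K →L[ℂ] HilbertTensor H K}
    (h : ∀ x y, S (tensorVec x y) = T (tensorVec x y)) : S = T := by
  ext z
  induction z using UniformSpace.Completion.induction_on with
  | hp => exact isClosed_eq S.continuous T.continuous
  | ih z =>
    induction z using TensorProduct.induction_on with
    | zero =>
      have h0 : ((0 : H ⊗[ℂ] K) : HilbertTensor H K) = 0 :=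
        map_zero (UniformSpace.Completion.toComplL (𝕜 := ℂ) (E := H ⊗[ℂ] K))
      rw [h0, map_zero, map_zero]
    | tmul x y => exact h x y
    | add u v hu hv =>
      have huv : ((u + v : H ⊗[ℂ] K) : HilbertTensor H K) = u + v :=
        map_add (UniformSpace.Completion.toComplL (𝕜 := ℂ)) u v
      rw [huv, map_add, map_add, hu, hv]

theorem tensorVec_add_left (x x' : H) (y : K) :
    tensorVec (x + x') y = tensorVec x y + tensorVec x' y := by
  simp only [← tensorVecL_apply, map_add, add_apply]

theorem tensorVec_smul_left (z : ℂ) (x : H) (y : K) :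
    tensorVec (z • x) y = z • tensorVec x y := by
  simp only [← tensorVecL_apply, map_smul, smul_apply]

theorem tensorVec_smul_right (z : ℂ) (x : H) (y : K) :
    tensorVec x (z • y) = z • tensorVec x y := by
  simp only [← tensorVecL_apply, map_smul]

theorem tensorOp_add_left (A A' : H →L[ℂ] H) (B : K →L[ℂ] K) :
    tensorOp (A + A') B = tensorOp A B + tensorOp A' B :=
  ext_tensorVec fun x y => by simp [tensorOp_tensorVec, tensorVec_add_left]

theorem tensorOp_smul_left (z : ℂ) (A : H →L[ℂ] H) (B : K →L[ℂ] K) :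
    tensorOp (z • A) B = z • tensorOp A B :=
  ext_tensorVec fun x y => by simp [tensorOp_tensorVec, tensorVec_smul_left]

/-- The tensor product of trace-class operators is trace class. -/
theorem IsTraceClass.tensorOp {S : H →L[ℂ] H} {T : K →L[ℂ] K} (hS : IsTraceClass S)
    (hT : IsTraceClass T) : IsTraceClass (tensorOp S T) := by
  obtain ⟨a, b, h1, h2⟩ := hS
  obtain ⟨c, d, h3, h4⟩ := hT
  have hsum : Summable (fun p : ℕ × ℕ =>
      ‖tensorVec (a p.1) (c p.2)‖ * ‖tensorVec (b p.1) (d p.2)‖) := by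
    refine (h1.mul_of_nonneg h3 (fun _ => by positivity) (fun _ => by positivity)).congr ?_
    intro p
    simp only [norm_tensorVec]
    ring
  have hs : Summable (fun p : ℕ × ℕ => InnerProductSpace.rankOne ℂ
      (tensorVec (a p.1) (c p.2)) (tensorVec (b p.1) (d p.2))) :=
    Summable.of_norm (by simpa using hsum)
  refine IsTraceClass.of_index (ι := ℕ × ℕ) _ _ hsum ?_
  convert hs.hasSum
  refine ext_tensorVec fun x y => ?_
  have e1 : HasSum (fun n => inner ℂ (b n) x • a n) (S x) := by
    simpa using (ContinuousLinearMap.apply ℂ H x).hasSum h2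
  have e2 : HasSum (fun n => inner ℂ (d n) y • c n) (T y) := by
    simpa using (ContinuousLinearMap.apply ℂ K y).hasSum h4
  have e3 := (ContinuousLinearMap.apply ℂ (HilbertTensor H K) (tensorVec x y)).hasSum hs.hasSum
  have e4 : HasSum (fun p : ℕ × ℕ => tensorVec (inner ℂ (b p.1) x • a p.1)
      (inner ℂ (d p.2) y • c p.2)) ((∑' p : ℕ × ℕ, InnerProductSpace.rankOne ℂ
      (tensorVec (a p.1) (c p.2)) (tensorVec (b p.1) (d p.2))) (tensorVec x y)) := by
    convert e3 using 2 with p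
    · simp [tensorVec_smul_left, tensorVec_smul_right, inner_tensorVec, smul_smul, mul_comm]
    · rfl
  have e5 := e4.prod_fiberwise (g := fun n => tensorVec (inner ℂ (b n) x • a n) (T y))
    (fun n => (tensorVecL H K (inner ℂ (b n) x • a n)).hasSum e2)
  have e6 : HasSum (fun n => tensorVec (inner ℂ (b n) x • a n) (T y)) (tensorVec (S x) (T y)) :=
    ((tensorVecL H K).flip (T y)).hasSum e1
  rw [tensorOp_tensorVec]
  exact e6.unique e5

variable (H) in
/-- The preparation map `T ↦ T ⊗ ξ`. -/
def preparation (ξ : K →L[ℂ] K) (hξ : IsTraceClass ξ) :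
    traceClass H →ₗ[ℂ] traceClass (HilbertTensor H K) where
  toFun T := ⟨tensorOp T.1 ξ, IsTraceClass.tensorOp T.2 hξ⟩
  map_add' S T := Subtype.ext (tensorOp_add_left S.1 T.1 ξ)
  map_smul' z T := Subtype.ext (tensorOp_smul_left z T.1 ξ)

/-- The additive quantity `N = N_S ⊗ 1 + 1 ⊗ N_A`. -/
def additive (NS : H →L[ℂ] H) (NA : K →L[ℂ] K) : HilbertTensor H K →L[ℂ] HilbertTensor H K :=
  tensorOp NS 1 + tensorOp 1 NA

variable [CompleteSpace H] [CompleteSpace K]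

variable (H) in
/-- The restriction map `Γ_ξ : ℒ(H ⊗ K) → ℒ(H)`, dual to the preparation map:
`tr[Γ_ξ(B) T] = tr[B (T ⊗ ξ)]`. -/
def restriction (ξ : K →L[ℂ] K) (hξ : IsTraceClass ξ)
    (B : HilbertTensor H K →L[ℂ] HilbertTensor H K) : H →L[ℂ] H :=
  dual (preparation H ξ hξ) B

end Tensor

/-! ### Observables -/

section Observable

variable {H : Type*} [NormedAddCommGroup H] [InnerProductSpace ℂ H] {X : Type*}

/-- (Discrete) observables, i.e. normalised POVMs with value space `X`: positive operators `E(x)`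
with `∑ₓ E(x) = 1` in the weak operator topology. -/
structure IsObservable (E : X → (H →L[ℂ] H)) : Prop where
  positive : ∀ x, (E x).IsPositive
  sum_eq_one : ∀ φ ψ : H, HasSum (fun x => inner ℂ φ (E x ψ)) (inner ℂ φ ψ)

/-- Extremal observables: extreme points of the convex set of observables with the same value
space, i.e. `E = λ E₁ + (1 - λ) E₂` with `0 < λ < 1` only if `E₁ = E₂ = E`. -/
def IsExtremalObservable (E : X → (H →L[ℂ] H)) : Prop :=
  E ∈ Set.extremePoints ℝ {F : X → (H →L[ℂ] H) | IsObservable F}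

/-- Sharp observables: the effects are mutually orthogonal projections. -/
structure IsSharpObservable (E : X → (H →L[ℂ] H)) : Prop where
  isObservable : IsObservable E
  idempotent : ∀ x, E x * E x = E x
  orthogonal : ∀ x y, x ≠ y → E x * E y = 0

end Observable

/-! ### Variance and quantum Fisher information -/

section Fisher

variable {H : Type*} [NormedAddCommGroup H] [InnerProductSpace ℂ H] [CompleteSpace H]

/-- The variance `tr[N² ρ] - tr[N ρ]²` of a self-adjoint operator `N` in the state `ρ`. -/
def variance (N ρ : H →L[ℂ] H) : ℝ := (trace (N ^ 2 * ρ)).re - (trace (N * ρ)).re ^ 2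

/-- `(qᵢ, φᵢ)` is an ensemble of unit vectors with `∑ᵢ qᵢ |φᵢ⟩⟨φᵢ| = ρ`; finite ensembles are
those with all but finitely many `qᵢ` equal to `0`. -/
structure IsPureEnsemble (ρ : H →L[ℂ] H) (q : ℕ → ℝ) (φ : ℕ → H) : Prop where
  nonneg : ∀ i, 0 ≤ q i
  sum_eq_one : HasSum q 1
  norm_eq_one : ∀ i, ‖φ i‖ = 1
  hasSum : HasSum (fun i => (q i : ℂ) • InnerProductSpace.rankOne ℂ (φ i) (φ i)) ρ

/-- The quantum Fisher information of `N` in the state `ρ`: four times the convex roof of the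
variance. -/
def fisherInformation (N ρ : H →L[ℂ] H) : ℝ :=
  4 * sInf {v : ℝ | ∃ (q : ℕ → ℝ) (φ : ℕ → H), IsPureEnsemble ρ q φ ∧
    v = ∑' i, q i * variance N (InnerProductSpace.rankOne ℂ (φ i) (φ i))}

end Fisher

/-! ### Measurement schemes -/

section Scheme

/-- A measurement scheme `(H_A, ξ, ℰ, Z)` for a system with Hilbert space `HS`: an apparatus with
Hilbert space `HA`, prepared in the state `ξ`, interacts with the system through the channel `ℰ`,
and then the pointer observable `Z` of the apparatus is measured. -/
structure MeasurementScheme (HS HA X : Type*)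
    [NormedAddCommGroup HS] [InnerProductSpace ℂ HS]
    [NormedAddCommGroup HA] [InnerProductSpace ℂ HA] [CompleteSpace HA] where
  /-- The state of the apparatus. -/
  ξ : HA →L[ℂ] HA
  isState : IsState ξ
  /-- The interaction channel. -/
  interaction : traceClass (HilbertTensor HS HA) →ₗ[ℂ] traceClass (HilbertTensor HS HA)
  isChannel : IsChannel interaction
  /-- The pointer observable. -/
  pointer : X → (HA →L[ℂ] HA)
  isObservable : IsObservable pointer

variable {HS HA X : Type*}
  [NormedAddCommGroup HS] [InnerProductSpace ℂ HS] [CompleteSpace HS]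
  [NormedAddCommGroup HA] [InnerProductSpace ℂ HA] [CompleteSpace HA]

/-- The Heisenberg-evolved pointer `Z^τ(x) = ℰ*(1 ⊗ Z(x))`. -/
def MeasurementScheme.evolvedPointer (M : MeasurementScheme HS HA X) (x : X) :
    HilbertTensor HS HA →L[ℂ] HilbertTensor HS HA :=
  dual M.interaction (tensorOp 1 (M.pointer x))

/-- The effects `Γ_ξ(ℰ*(1 ⊗ Z(x)))` of the observable that the scheme measures. -/
def MeasurementScheme.measured (M : MeasurementScheme HS HA X) (x : X) : HS →L[ℂ] HS :=
  restriction HS M.ξ M.isState.traceClass (M.evolvedPointer x)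

/-- The error `ε(x) = Γ_ξ(ℰ*(1 ⊗ Z(x))) - E(x)` relative to the target observable `E`. -/
def MeasurementScheme.error (M : MeasurementScheme HS HA X) (E : X → (HS →L[ℂ] HS)) (x : X) :
    HS →L[ℂ] HS :=
  M.measured x - E x

/-- `M` is a measurement scheme for `E`: the measured observable is `E`, without error. -/
def MeasurementScheme.Measures (M : MeasurementScheme HS HA X) (E : X → (HS →L[ℂ] HS)) : Prop :=
  ∀ x, M.measured x = E x

/-- The weak Yanase condition `[Z^τ, N] = 0` for `N = N_S ⊗ 1 + 1 ⊗ N_A`. -/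
def MeasurementScheme.WeakYanase (M : MeasurementScheme HS HA X)
    (NS : HS →L[ℂ] HS) (NA : HA →L[ℂ] HA) : Prop :=
  ∀ x, ⁅M.evolvedPointer x, additive NS NA⁆ = 0

end Scheme

end QuantumMeasurement

end

open scoped TensorProduct ComplexOrder

noncomputable section

namespace QuantumMeasurement

/-! ### Traces of nuclear expansions and decomposition of states into pure states. -/

section Trace

variable {H : Type*} [NormedAddCommGroup H] [InnerProductSpace ℂ H] [CompleteSpace H]

/-! Let `A` be an effect on the composite system that commutes with `N = N_S ⊗ 1 + 1 ⊗ N_A`, and let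
`G` be its restriction to the system. If `ξ` is a mixture of `|φᵢ⟩⟨φᵢ|` with weights `qᵢ`, the
matrix elements of `G` are the `qᵢ`-averages of `⟨ψ ⊗ φᵢ, A (χ ⊗ φᵢ)⟩`. Commutation with `N` moves
`N_S` over to `N_A`, so `⟨ψ, [G, N_S] χ⟩` is a difference of two averages of the form `⟨A (ψ ⊗ φᵢ),
χ ⊗ (N_A - m) φᵢ⟩`. When `m` is the mean of `N_A` in `ξ`, subtracting `Gψ ⊗ φᵢ` in the left slot
changes nothing. Cauchy–Schwarz together with `A² ≤ A` then bounds each average by `⟨ψ, (G - G²)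
ψ⟩^{1/2} Var(N_A, ξ)^{1/2} ‖χ‖`. This is `covariance_bound`, and `norm_commutator_le_of_ensemble` is
the resulting commutator estimate.

All the bounds come from this one estimate. Applied to the whole mixture it gives the variance
bound. Applied to each `φᵢ` separately, with `G - G² ≤ 1/4`, and averaged by Cauchy–Schwarz, it
bounds the squared commutator by the average of the pure-state variances; the infimum over ensembles
is the Fisher information. Replacing `G` by `E(x)` costs only terms in `ε(x)`.

If the measured observable is `E` and `E` is extremal, every `φᵢ` of positive weight must already
measure `E`, by `compress_eq_of_isExtremal`. The pure-state estimate then keeps the factor `‖E(x) -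
E(x)²‖`, and its square can be averaged. -/

omit [CompleteSpace H] in
theorem summable_inner_mul_inner_prod {ι κ : Type*} {e : κ → H} (he : Orthonormal ℂ e)
    {a b : ι → H} (hs : Summable fun n => ‖a n‖ * ‖b n‖) :
    Summable fun p : ι × κ => inner ℂ (b p.1) (e p.2) * inner ℂ (e p.2) (a p.1) := by
  -- For fixed `n`, Cauchy–Schwarz and Bessel bound the absolute row sums, so the double series is
  -- absolutely summable.
  have bound : ∀ n (s : Finset κ),
      ∑ i ∈ s, ‖inner ℂ (b n) (e i) * inner ℂ (e i) (a n)‖ ≤ ‖a n‖ * ‖b n‖ := by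
    intro n s
    have h1 := Real.sum_mul_le_sqrt_mul_sqrt s (fun i => ‖inner ℂ (e i) (b n)‖)
      (fun i => ‖inner ℂ (e i) (a n)‖)
    have ha : √(∑ i ∈ s, ‖inner ℂ (e i) (a n)‖ ^ 2) ≤ ‖a n‖ :=
      (Real.sqrt_le_left (norm_nonneg _)).2 (he.sum_inner_products_le (a n))
    have hb : √(∑ i ∈ s, ‖inner ℂ (e i) (b n)‖ ^ 2) ≤ ‖b n‖ :=
      (Real.sqrt_le_left (norm_nonneg _)).2 (he.sum_inner_products_le (b n))
    calc _ = ∑ i ∈ s, ‖inner ℂ (e i) (b n)‖ * ‖inner ℂ (e i) (a n)‖ := by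
          simp only [norm_mul, norm_inner_symm (b n)]
      _ ≤ _ := h1
      _ ≤ ‖b n‖ * ‖a n‖ := by gcongr
      _ = _ := mul_comm _ _
  apply Summable.of_norm
  rw [summable_prod_of_nonneg (fun _ => norm_nonneg _)]
  refine ⟨fun n => summable_of_sum_le (fun _ => norm_nonneg _) (bound n), ?_⟩
  exact hs.of_nonneg_of_le (fun n => tsum_nonneg fun _ => norm_nonneg _)
    (fun n => Real.tsum_le_of_sum_le (fun _ => norm_nonneg _) (bound n))

/-- Fubini for the double series `⟨bₙ, eᵢ⟩⟨eᵢ, aₙ⟩`: summing over `i` first is Parseval, summing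
over `n` first gives the diagonal elements of `T`. Thus the trace can be computed from any nuclear
expansion. -/
theorem hasSum_trace {ι : Type*} {a b : ι → H} {T : H →L[ℂ] H}
    (hs : Summable fun n => ‖a n‖ * ‖b n‖)
    (hT : HasSum (fun n => InnerProductSpace.rankOne ℂ (a n) (b n)) T) :
    HasSum (fun n => inner ℂ (b n) (a n)) (trace T) ∧
      HasSum (fun i => inner ℂ (onb H i) (T (onb H i))) (trace T) := by
  have hF := summable_inner_mul_inner_prod (onb H).orthonormal hs
  have h1 := hF.hasSum.prod_fiberwise (fun n => (onb H).hasSum_inner_mul_inner (b n) (a n))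
  have h2 := ((Equiv.prodComm _ _).hasSum_iff.2 hF.hasSum).prod_fiberwise
    (g := fun i => inner ℂ (onb H i) (T (onb H i))) (fun i => by
      have := (innerSL ℂ (onb H i)).hasSum ((ContinuousLinearMap.apply ℂ H (onb H i)).hasSum hT)
      simpa [Function.comp_def, inner_smul_right] using this)
  have h3 : trace T = _ := h2.tsum_eq
  rw [h3]
  exact ⟨h1, h2⟩

theorem trace_mul {ι : Type*} {a b : ι → H} {T : H →L[ℂ] H} (B : H →L[ℂ] H)
    (hs : Summable fun n => ‖a n‖ * ‖b n‖)
    (hT : HasSum (fun n => InnerProductSpace.rankOne ℂ (a n) (b n)) T) :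
    HasSum (fun n => inner ℂ (b n) (B (a n))) (trace (B * T)) := by
  refine (hasSum_trace (a := fun n => B (a n)) (b := b) ?_ ?_).1
  · refine (hs.mul_left ‖B‖).of_nonneg_of_le (fun n => by positivity) fun n => ?_
    rw [← mul_assoc]
    gcongr
    exact B.le_opNorm _
  · have := (ContinuousLinearMap.compL ℂ H H H B).hasSum hT
    convert this using 2 with n
    · ext; simp
    · rfl

theorem trace_mul_rankOne (B : H →L[ℂ] H) (u v : H) :
    trace (B * InnerProductSpace.rankOne ℂ u v) = inner ℂ v (B u) := by
  have := trace_mul (ι := Unit) (a := fun _ => u) (b := fun _ => v) B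
    (hasSum_unique _).summable (hasSum_unique _)
  exact this.unique (hasSum_unique _)

theorem isTraceClass_rankOne (u v : H) : IsTraceClass (InnerProductSpace.rankOne ℂ u v) := by
  refine ⟨Pi.single 0 u, Pi.single 0 v, ?_, ?_⟩
  · exact summable_of_ne_finset_zero (s := {0}) fun n hn => by
      simp [Pi.single_eq_of_ne (Finset.notMem_singleton.1 hn)]
  · convert hasSum_single (0 : ℕ) ?_ using 1
    · simp
    · intro n hn
      simp [Pi.single_eq_of_ne hn]

theorem IsTraceClass.hasSum_onb {T : H →L[ℂ] H} (hT : IsTraceClass T) :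
    HasSum (fun i => inner ℂ (onb H i) (T (onb H i))) (trace T) := by
  obtain ⟨a, b, hs, h⟩ := hT
  exact (hasSum_trace hs h).2

/-- A positive trace-class operator is a sum of positive rank-one operators. -/
theorem IsTraceClass.exists_hasSum_rankOne {P : H →L[ℂ] H} (hP : IsTraceClass P)
    (hpos : P.IsPositive) : ∃ s : basisIndex H → H, HasSum (fun i => ‖s i‖ ^ 2) (trace P).re ∧
      HasSum (fun i => InnerProductSpace.rankOne ℂ (s i) (s i)) P := by
  have hP0 : 0 ≤ P := ContinuousLinearMap.nonneg_iff_isPositive _ |>.2 hpos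
  set S := CFC.sqrt P with hS
  have hSS : S * S = P := CFC.sqrt_mul_sqrt_self P
  have hSpos : S.IsPositive := (ContinuousLinearMap.nonneg_iff_isPositive _).1 (CFC.sqrt_nonneg P)
  have hSsymm : ∀ u v, inner ℂ (S u) v = inner ℂ u (S v) := hSpos.isSymmetric
  have h1 : HasSum (fun i => ‖S (onb H i)‖ ^ 2) (trace P).re := by
    have := Complex.hasSum_re hP.hasSum_onb
    convert this using 2 with i
    rw [← hSS, mul_apply_eq_comp, ← hSsymm, ← inner_self_eq_norm_sq (𝕜 := ℂ)]
    rfl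
  -- With `S = √P`, expanding `S x` in the basis and applying `S` gives `P = ∑ᵢ |S eᵢ⟩⟨S eᵢ|`.
  refine ⟨fun i => S (onb H i), h1, ?_⟩
  have h2 : Summable fun i => InnerProductSpace.rankOne ℂ (S (onb H i)) (S (onb H i)) :=
    Summable.of_norm (by simpa [← sq] using h1.summable)
  convert h2.hasSum
  ext x
  have h3 := (ContinuousLinearMap.apply ℂ H x).hasSum h2.hasSum
  have h4 := S.hasSum ((onb H).hasSum_repr (S x))
  rw [← mul_apply_eq_comp, hSS] at h4
  refine h4.unique ?_
  convert h3 using 2 with i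
  · simp [HilbertBasis.repr_apply_apply, hSsymm]
  · rfl

-- Distinct orthonormal vectors are `√2` apart, so balls of radius `1/2` around them are disjoint
-- open sets.
omit [CompleteSpace H] in
theorem _root_.Orthonormal.countable [TopologicalSpace.SeparableSpace H] {ι : Type*} {e : ι → H}
    (he : Orthonormal ℂ e) : Countable ι := by
  refine Pairwise.countable_of_isOpen_disjoint (s := fun i => Metric.ball (e i) (1 / 2)) ?_
    (fun _ => Metric.isOpen_ball) (fun i => ⟨e i, Metric.mem_ball_self (by norm_num)⟩)
  intro i j hij
  refine Metric.ball_disjoint_ball ?_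
  have h : ‖e i - e j‖ ^ 2 = 2 := by
    rw [@norm_sub_sq ℂ, he.1, he.1, he.2 hij]
    norm_num
  rw [dist_eq_norm]
  nlinarith [norm_nonneg (e i - e j)]

open Classical in
/-- Every state is a mixture of countably many pure states. -/
theorem IsState.exists_isPureEnsemble [TopologicalSpace.SeparableSpace H] {ρ : H →L[ℂ] H}
    (hρ : IsState ρ) : ∃ (q : ℕ → ℝ) (φ : ℕ → H), IsPureEnsemble ρ q φ := by
  obtain ⟨s, h1, h2⟩ := hρ.traceClass.exists_hasSum_rankOne hρ.positive
  rw [hρ.trace_eq_one, Complex.one_re] at h1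
  -- An ensemble needs a unit vector even where the weight is zero; the normalised `s i₀` fills
  -- those places.
  obtain ⟨i₀, hi₀⟩ : ∃ i, s i ≠ 0 := by
    by_contra! h
    simp [h] at h1
    exact zero_ne_one (hasSum_zero.unique h1)
  have hc : Countable (basisIndex H) := (onb H).orthonormal.countable
  obtain ⟨f, hf⟩ := exists_injective_nat (basisIndex H)
  set s' : ℕ → H := Function.extend f s 0 with hs'
  have hout : ∀ n, n ∉ Set.range f → s' n = 0 := fun n hn => by
    rw [hs', Function.extend_apply' _ _ _ (by simpa using hn)]; rfl
  have hin : ∀ i, s' (f i) = s i := fun i => hf.extend_apply _ _ _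
  refine ⟨fun n => ‖s' n‖ ^ 2, fun n => if s' n = 0 then (‖s i₀‖⁻¹ : ℂ) • s i₀
    else (‖s' n‖⁻¹ : ℂ) • s' n, fun n => by positivity, ?_, fun n => ?_, ?_⟩
  · rw [← hf.hasSum_iff (fun n hn => by simp [hout n hn])]
    simpa [Function.comp_def, hin] using h1
  · split_ifs with h
    · simp [norm_smul, hi₀]
    · simp [norm_smul, h]
  · rw [← hf.hasSum_iff (fun n hn => by simp [hout n hn])]
    convert h2 using 2 with i
    by_cases h : s i = 0
    · simp [hin, h]
    · have : (‖s i‖ : ℂ) ≠ 0 := by simpa using h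
      ext x
      simp [hin, h, smul_smul]
      field_simp

end Trace

/-! ### Operators on the tensor product, slices and the restriction map. -/

section Tensor

variable {H K : Type*} [NormedAddCommGroup H] [InnerProductSpace ℂ H]
  [NormedAddCommGroup K] [InnerProductSpace ℂ K]

theorem tensorVec_add_right (x : H) (y y' : K) :
    tensorVec x (y + y') = tensorVec x y + tensorVec x y' := by
  simp only [← tensorVecL_apply, map_add]

theorem tensorVec_sub_right (x : H) (y y' : K) :
    tensorVec x (y - y') = tensorVec x y - tensorVec x y' := by
  simp only [← tensorVecL_apply, map_sub]

theorem tensorOp_mul (A A' : H →L[ℂ] H) (B B' : K →L[ℂ] K) :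
    tensorOp A B * tensorOp A' B' = tensorOp (A * A') (B * B') :=
  ext_tensorVec fun x y => by simp [tensorOp_tensorVec]

theorem tensorOp_one : tensorOp (1 : H →L[ℂ] H) (1 : K →L[ℂ] K) = 1 :=
  ext_tensorVec fun x y => by simp [tensorOp_tensorVec]

variable (H) in
/-- `B ↦ 1 ⊗ B` is additive. -/
def oneTensor : (K →L[ℂ] K) →+ (HilbertTensor H K →L[ℂ] HilbertTensor H K) :=
  AddMonoidHom.mk' (tensorOp 1) fun B B' =>
    ext_tensorVec fun x y => by simp [tensorOp_tensorVec, tensorVec_add_right]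

theorem oneTensor_apply (B : K →L[ℂ] K) : oneTensor H B = tensorOp 1 B := rfl

/-- Nuclear expansions of two operators give one of their tensor product. -/
theorem hasSum_tensorOp {ι κ : Type*} {S : H →L[ℂ] H} {T : K →L[ℂ] K} {a b : ι → H} {c d : κ → K}
    (h1 : Summable fun n => ‖a n‖ * ‖b n‖)
    (h2 : HasSum (fun n => InnerProductSpace.rankOne ℂ (a n) (b n)) S)
    (h3 : Summable fun n => ‖c n‖ * ‖d n‖)
    (h4 : HasSum (fun n => InnerProductSpace.rankOne ℂ (c n) (d n)) T) :
    Summable (fun p : ι × κ => ‖tensorVec (a p.1) (c p.2)‖ * ‖tensorVec (b p.1) (d p.2)‖) ∧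
      HasSum (fun p : ι × κ => InnerProductSpace.rankOne ℂ
        (tensorVec (a p.1) (c p.2)) (tensorVec (b p.1) (d p.2))) (tensorOp S T) := by
  have hsum : Summable (fun p : ι × κ =>
      ‖tensorVec (a p.1) (c p.2)‖ * ‖tensorVec (b p.1) (d p.2)‖) := by
    refine (h1.mul_of_nonneg h3 (fun _ => by positivity) (fun _ => by positivity)).congr ?_
    intro p
    simp only [norm_tensorVec]
    ring
  have hs : Summable (fun p : ι × κ => InnerProductSpace.rankOne ℂ
      (tensorVec (a p.1) (c p.2)) (tensorVec (b p.1) (d p.2))) :=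
    Summable.of_norm (by simpa using hsum)
  refine ⟨hsum, ?_⟩
  convert hs.hasSum
  refine ext_tensorVec fun x y => ?_
  have e1 : HasSum (fun n => inner ℂ (b n) x • a n) (S x) := by
    simpa using (ContinuousLinearMap.apply ℂ H x).hasSum h2
  have e2 : HasSum (fun n => inner ℂ (d n) y • c n) (T y) := by
    simpa using (ContinuousLinearMap.apply ℂ K y).hasSum h4
  have e3 := (ContinuousLinearMap.apply ℂ (HilbertTensor H K) (tensorVec x y)).hasSum hs.hasSum
  have e4 : HasSum (fun p : ι × κ => tensorVec (inner ℂ (b p.1) x • a p.1)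
      (inner ℂ (d p.2) y • c p.2)) ((∑' p : ι × κ, InnerProductSpace.rankOne ℂ
      (tensorVec (a p.1) (c p.2)) (tensorVec (b p.1) (d p.2))) (tensorVec x y)) := by
    convert e3 using 2 with p
    · simp [tensorVec_smul_left, tensorVec_smul_right, inner_tensorVec, smul_smul, mul_comm]
    · rfl
  have e5 := e4.prod_fiberwise (g := fun n => tensorVec (inner ℂ (b n) x • a n) (T y))
    (fun n => (tensorVecL H K (inner ℂ (b n) x • a n)).hasSum e2)
  have e6 : HasSum (fun n => tensorVec (inner ℂ (b n) x • a n) (T y)) (tensorVec (S x) (T y)) :=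
    ((tensorVecL H K).flip (T y)).hasSum e1
  rw [tensorOp_tensorVec]
  exact e6.unique e5

/-- A vector orthogonal to all elementary tensors vanishes. -/
theorem eq_zero_of_inner_tensorVec {w : HilbertTensor H K}
    (h : ∀ x y, inner ℂ w (tensorVec x y) = 0) : w = 0 := by
  -- Density enters through operators: `|w⟩⟨w|` kills every elementary tensor, hence is zero.
  have : InnerProductSpace.rankOne ℂ w w = 0 := ext_tensorVec fun x y => by simp [h]
  simpa using this

variable [CompleteSpace H] [CompleteSpace K]

theorem adjoint_tensorOp (A : H →L[ℂ] H) (B : K →L[ℂ] K) :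
    (tensorOp A B).adjoint = tensorOp A.adjoint B.adjoint := by
  refine ext_tensorVec fun x y => sub_eq_zero.1 (eq_zero_of_inner_tensorVec fun x' y' => ?_)
  rw [inner_sub_left, ContinuousLinearMap.adjoint_inner_left, tensorOp_tensorVec,
    tensorOp_tensorVec, inner_tensorVec, inner_tensorVec, ContinuousLinearMap.adjoint_inner_left,
    ContinuousLinearMap.adjoint_inner_left, sub_self]

/-- `1 ⊗ B` is `C* C` for `C = 1 ⊗ √B`. -/
theorem isPositive_one_tensorOp {B : K →L[ℂ] K} (hB : B.IsPositive) :
    (tensorOp (1 : H →L[ℂ] H) B).IsPositive := by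
  have hB0 : 0 ≤ B := ContinuousLinearMap.nonneg_iff_isPositive _ |>.2 hB
  have hS : ContinuousLinearMap.adjoint (CFC.sqrt B) = CFC.sqrt B :=
    (ContinuousLinearMap.nonneg_iff_isPositive _ |>.1 (CFC.sqrt_nonneg B)).isSelfAdjoint.adjoint_eq
  have h1 : ContinuousLinearMap.adjoint (1 : H →L[ℂ] H) = 1 := ContinuousLinearMap.adjoint_id
  have : tensorOp (1 : H →L[ℂ] H) B
      = (tensorOp 1 (CFC.sqrt B)).adjoint.comp (tensorOp 1 (CFC.sqrt B)) := by
    rw [adjoint_tensorOp, hS, h1]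
    have := tensorOp_mul (1 : H →L[ℂ] H) 1 (CFC.sqrt B) (CFC.sqrt B)
    rw [CFC.sqrt_mul_sqrt_self B, one_mul] at this
    exact this.symm
  rw [this]
  exact ContinuousLinearMap.isPositive_adjoint_comp_self _

variable (H) in
/-- The isometry `ψ ↦ ψ ⊗ φ`, up to the factor `‖φ‖`. -/
def slice (φ : K) : H →L[ℂ] HilbertTensor H K := (tensorVecL H K).flip φ

omit [CompleteSpace H] [CompleteSpace K] in
theorem slice_apply (φ : K) (ψ : H) : slice H φ ψ = tensorVec ψ φ := rfl

/-- The restriction map of the pure state `|φ⟩⟨φ|`. -/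
def compress (φ : K) (B : HilbertTensor H K →L[ℂ] HilbertTensor H K) : H →L[ℂ] H :=
  (slice H φ).adjoint ∘L B ∘L slice H φ

omit [CompleteSpace K] in
theorem inner_compress (φ : K) (B : HilbertTensor H K →L[ℂ] HilbertTensor H K) (ψ χ : H) :
    inner ℂ ψ (compress φ B χ) = inner ℂ (tensorVec ψ φ) (B (tensorVec χ φ)) := by
  simp [compress, ContinuousLinearMap.adjoint_inner_right, slice_apply]

omit [CompleteSpace K] in
theorem norm_compress_le {φ : K} (hφ : ‖φ‖ = 1)
    (B : HilbertTensor H K →L[ℂ] HilbertTensor H K) : ‖compress φ B‖ ≤ ‖B‖ := by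
  refine ContinuousLinearMap.opNorm_le_of_re_inner_le (norm_nonneg B) fun χ ψ hχ hψ => ?_
  rw [← inner_re_symm, inner_compress]
  calc _ ≤ ‖tensorVec ψ φ‖ * ‖B (tensorVec χ φ)‖ := re_inner_le_norm (𝕜 := ℂ) _ _
    _ ≤ ‖tensorVec ψ φ‖ * (‖B‖ * ‖tensorVec χ φ‖) := by gcongr; exact B.le_opNorm _
    _ = ‖B‖ := by rw [norm_tensorVec, norm_tensorVec, hφ, hχ, hψ]; ring

omit [CompleteSpace K] in
theorem IsPureEnsemble.summable {ξ : K →L[ℂ] K} {q : ℕ → ℝ} {φ : ℕ → K}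
    (h : IsPureEnsemble ξ q φ) : Summable fun i => ‖(q i : ℂ) • φ i‖ * ‖φ i‖ := by
  refine h.sum_eq_one.summable.congr fun i => ?_
  simp [norm_smul, h.norm_eq_one, abs_of_nonneg (h.nonneg i)]

omit [CompleteSpace K] in
theorem IsPureEnsemble.hasSum_rankOne {ξ : K →L[ℂ] K} {q : ℕ → ℝ} {φ : ℕ → K}
    (h : IsPureEnsemble ξ q φ) :
    HasSum (fun i => InnerProductSpace.rankOne ℂ ((q i : ℂ) • φ i) (φ i)) ξ := by
  simpa using h.hasSum

omit [CompleteSpace H] in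
theorem ext_inner_op {S T : H →L[ℂ] H} (h : ∀ ψ χ, inner ℂ ψ (S χ) = inner ℂ ψ (T χ)) : S = T :=
  ContinuousLinearMap.ext fun χ => ext_inner_left ℂ fun ψ => h ψ χ

/-- Testing on `|χ⟩⟨ψ|` recovers every matrix element, so the operator chosen in `dual` is forced to
be `G`. -/
theorem dual_eq {Φ : traceClass H →ₗ[ℂ] traceClass K} {A : K →L[ℂ] K} {G : H →L[ℂ] H}
    (hG : ∀ T : traceClass H, trace (G * (T : H →L[ℂ] H)) = trace (A * (Φ T : K →L[ℂ] K))) :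
    dual Φ A = G := by
  have h : ∃ B : H →L[ℂ] H, ∀ T : traceClass H,
      trace (B * (T : H →L[ℂ] H)) = trace (A * (Φ T : K →L[ℂ] K)) := ⟨G, hG⟩
  rw [dual, dif_pos h]
  refine ext_inner_op fun ψ χ => ?_
  have := (h.choose_spec ⟨_, isTraceClass_rankOne χ ψ⟩).trans (hG ⟨_, isTraceClass_rankOne χ ψ⟩).symm
  simpa only [trace_mul_rankOne] using this

omit [CompleteSpace K] in
/-- The restriction map of a mixture of pure states. -/
theorem IsPureEnsemble.hasSum_restriction {ξ : K →L[ℂ] K} {q : ℕ → ℝ} {φ : ℕ → K}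
    (h : IsPureEnsemble ξ q φ) (hξ : IsTraceClass ξ)
    (B : HilbertTensor H K →L[ℂ] HilbertTensor H K) :
    HasSum (fun i => (q i : ℂ) • compress (φ i) B) (restriction H ξ hξ B) := by
  have hs : Summable fun i => (q i : ℂ) • compress (H := H) (φ i) B := by
    refine Summable.of_norm_bounded (h.sum_eq_one.summable.mul_right ‖B‖) fun i => ?_
    rw [norm_smul, Complex.norm_real, Real.norm_of_nonneg (h.nonneg i)]
    exact mul_le_mul_of_nonneg_left (norm_compress_le (h.norm_eq_one i) B) (h.nonneg i)
  convert hs.hasSum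
  refine dual_eq fun T => ?_
  obtain ⟨a, b, h1, h2⟩ := T.2
  have h3 := trace_mul (∑' i, (q i : ℂ) • compress (H := H) (φ i) B) h1 h2
  -- Expand `T ⊗ ξ` over pairs `(n, i)`; summing over `i` first produces the compressions, and then
  -- the sum over `n` is a trace against `T`.
  obtain ⟨h4, h5⟩ := hasSum_tensorOp h1 h2 h.summable h.hasSum_rankOne
  have h6 : ∀ n, HasSum (fun i => inner ℂ (tensorVec (b n) (φ i))
      (B (tensorVec (a n) ((q i : ℂ) • φ i))))
      (inner ℂ (b n) ((∑' i, (q i : ℂ) • compress (H := H) (φ i) B) (a n))) := fun n => by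
    have := (innerSL ℂ (b n)).hasSum ((ContinuousLinearMap.apply ℂ H (a n)).hasSum hs.hasSum)
    have e : (fun i => inner ℂ (tensorVec (b n) (φ i)) (B (tensorVec (a n) ((q i : ℂ) • φ i)))) =
        fun i => innerSL ℂ (b n) (ContinuousLinearMap.apply ℂ H (a n)
          ((q i : ℂ) • compress (φ i) B)) := by
      funext i
      rw [tensorVec_smul_right, map_smul, inner_smul_right]
      simp [inner_compress]
    rw [e]
    exact this
  exact h3.unique ((trace_mul B h4 h5).prod_fiberwise h6)

end Tensor

/-! ### Positivity and normalisation of the evolved pointer. -/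

section Scheme

variable {H : Type*} [NormedAddCommGroup H] [InnerProductSpace ℂ H] [CompleteSpace H]

omit [CompleteSpace H] in
theorem isPositive_of_inner_nonneg {T : H →L[ℂ] H} (h : ∀ u, (0 : ℂ) ≤ inner ℂ u (T u)) :
    T.IsPositive := by
  rw [ContinuousLinearMap.isPositive_iff_complex]
  intro x
  have h1 := Complex.nonneg_iff.1 (h x)
  have h2 : inner ℂ (T x) x = inner ℂ x (T x) := by
    rw [← inner_conj_symm, Complex.conj_eq_iff_im, h1.2]
  rw [h2]
  exact ⟨Complex.ext rfl h1.2, h1.1⟩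

variable {HS HA X : Type*}
  [NormedAddCommGroup HS] [InnerProductSpace ℂ HS] [CompleteSpace HS]
  [NormedAddCommGroup HA] [InnerProductSpace ℂ HA] [CompleteSpace HA]

omit [CompleteSpace H] in
theorem IsObservable.sum_le {E : X → (H →L[ℂ] H)} (hE : IsObservable E) (F : Finset X) (u : H) :
    ∑ x ∈ F, inner ℂ u (E x u) ≤ inner ℂ u u :=
  sum_le_hasSum F (fun x _ => (hE.positive x).inner_nonneg_right u) (hE.sum_eq_one u u)

theorem IsObservable.sum_one_tensorOp_le {Z : X → (HA →L[ℂ] HA)} (hZ : IsObservable Z)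
    (F : Finset X) (u : HilbertTensor HS HA) :
    ∑ x ∈ F, inner ℂ u (tensorOp (1 : HS →L[ℂ] HS) (Z x) u) ≤ inner ℂ u u := by
  have h : (1 - ∑ x ∈ F, Z x).IsPositive := isPositive_of_inner_nonneg fun v => by
    simpa [inner_sub_right, sum_apply, inner_sum] using hZ.sum_le F v
  have := (isPositive_one_tensorOp (H := HS) h).inner_nonneg_right u
  rw [← oneTensor_apply, map_sub, map_sum, oneTensor_apply, tensorOp_one] at this
  simpa [inner_sub_right, sum_apply, inner_sum, oneTensor_apply] using this

/-- Complete positivity for `1 × 1` matrices. -/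
theorem IsChannel.isPositive_apply {Φ : traceClass H →ₗ[ℂ] traceClass HA} (hΦ : IsChannel Φ) (u : H) :
    (Φ ⟨_, isTraceClass_rankOne u u⟩ : HA →L[ℂ] HA).IsPositive := by
  refine isPositive_of_inner_nonneg fun v => ?_
  have := hΦ.completelyPositive 1 (fun _ _ => ⟨_, isTraceClass_rankOne u u⟩)
    (fun ψ => by
      simpa using (InnerProductSpace.isPositive_rankOne_self (𝕜 := ℂ) u).inner_nonneg_right (ψ 0))
    (fun _ => v)
  simpa using this

theorem IsTraceClass.trace_mul_bounds {P : H →L[ℂ] H} (hP : IsTraceClass P) (hpos : P.IsPositive)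
    {Z : X → (H →L[ℂ] H)} (hZ : ∀ x, (Z x).IsPositive)
    (hZsum : ∀ (F : Finset X) (u : H), ∑ x ∈ F, inner ℂ u (Z x u) ≤ inner ℂ u u) :
    (∀ x, 0 ≤ trace (Z x * P)) ∧ ∀ F : Finset X, ∑ x ∈ F, trace (Z x * P) ≤ trace P := by
  obtain ⟨s, hs, hsP⟩ := hP.exists_hasSum_rankOne hpos
  have hs' : Summable fun i => ‖s i‖ * ‖s i‖ := hs.summable.congr fun i => sq _
  have htr := fun B => trace_mul B hs' hsP
  refine ⟨fun x => (htr (Z x)).nonneg fun i => (hZ x).inner_nonneg_right (s i), fun F => ?_⟩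
  exact hasSum_le (fun i => hZsum F (s i)) (hasSum_sum fun x _ => htr (Z x))
    (hasSum_trace hs' hsP).1

/-- The evolved pointer consists of positive operators whose finite sums are at most `1`. -/
theorem MeasurementScheme.evolvedPointer_bounds (M : MeasurementScheme HS HA X)
    (u : HilbertTensor HS HA) :
    (∀ x, (0 : ℂ) ≤ inner ℂ u (M.evolvedPointer x u)) ∧
      ∀ F : Finset X, ∑ x ∈ F, inner ℂ u (M.evolvedPointer x u) ≤ inner ℂ u u := by
  let T : traceClass (HilbertTensor HS HA) := ⟨_, isTraceClass_rankOne u u⟩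
  obtain ⟨h0, h1⟩ := IsTraceClass.trace_mul_bounds (M.interaction T).2
    (M.isChannel.isPositive_apply u) (Z := fun x => tensorOp 1 (M.pointer x))
    (fun x => isPositive_one_tensorOp (M.isObservable.positive x))
    (fun F v => M.isObservable.sum_one_tensorOp_le F v)
  have htr : trace (M.interaction T).1 = inner ℂ u u := by
    have h2 := trace_mul_rankOne (1 : HilbertTensor HS HA →L[ℂ] HilbertTensor HS HA) u u
    rw [one_mul] at h2
    exact (M.isChannel.trace_preserving T).trans h2
  -- Existence of the dual is not needed: the default value `0` satisfies both bounds, since the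
  -- terms it replaces are nonnegative.
  have hval : ∀ x, inner ℂ u (M.evolvedPointer x u) = 0 ∨ inner ℂ u (M.evolvedPointer x u) =
      trace (tensorOp 1 (M.pointer x) * (M.interaction T).1) := by
    intro x
    by_cases h : ∃ B : HilbertTensor HS HA →L[ℂ] HilbertTensor HS HA,
        ∀ T : traceClass (HilbertTensor HS HA),
          trace (B * T.1) = trace (tensorOp 1 (M.pointer x) * (M.interaction T).1)
    · right
      rw [MeasurementScheme.evolvedPointer, dual, dif_pos h]
      exact (trace_mul_rankOne h.choose u u).symm.trans (h.choose_spec T)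
    · left
      rw [MeasurementScheme.evolvedPointer, dual, dif_neg h]
      simp
  refine ⟨fun x => ?_, fun F => ?_⟩
  · rcases hval x with h | h <;> rw [h]
    exact h0 x
  · refine (Finset.sum_le_sum fun x _ => ?_).trans ((h1 F).trans_eq htr)
    rcases hval x with h | h <;> rw [h]
    exact h0 x

end Scheme

/-! ### The covariance inequality and the basic commutator estimate. -/

section Covariance

theorem hasSum_of_eq {ι M : Type*} [AddCommMonoid M] [TopologicalSpace M] {f g : ι → M} {a b : M}
    (h : HasSum f a) (hfg : ∀ i, g i = f i) (hab : b = a) : HasSum g b := by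
  rw [funext hfg, hab]
  exact h

/-- The Cauchy–Schwarz inequality for weighted sums of inner products. -/
theorem norm_le_of_hasSum_inner {L ι : Type*} [NormedAddCommGroup L] [InnerProductSpace ℂ L]
    {q : ι → ℝ} (hq : ∀ i, 0 ≤ q i) {a b : ι → L} {t : ℂ} {r : ι → ℝ} {α β : ℝ}
    (ht : HasSum (fun i => (q i : ℂ) * inner ℂ (a i) (b i)) t)
    (hr : ∀ i, q i * ‖a i‖ ^ 2 ≤ r i) (hα : HasSum r α)
    (hβ : HasSum (fun i => q i * ‖b i‖ ^ 2) β) : ‖t‖ ≤ √α * √β := by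
  refine le_of_tendsto ht.norm (Filter.Eventually.of_forall fun s => ?_)
  calc ‖∑ i ∈ s, (q i : ℂ) * inner ℂ (a i) (b i)‖
      ≤ ∑ i ∈ s, (√(q i) * ‖a i‖) * (√(q i) * ‖b i‖) := by
        refine norm_sum_le_of_le _ fun i _ => ?_
        rw [norm_mul, Complex.norm_real, Real.norm_of_nonneg (hq i)]
        calc _ ≤ q i * (‖a i‖ * ‖b i‖) := by
              gcongr
              · exact hq i
              · exact norm_inner_le_norm _ _
          _ = √(q i) * √(q i) * (‖a i‖ * ‖b i‖) := by rw [Real.mul_self_sqrt (hq i)]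
          _ = _ := by ring
    _ ≤ √(∑ i ∈ s, (√(q i) * ‖a i‖) ^ 2) * √(∑ i ∈ s, (√(q i) * ‖b i‖) ^ 2) :=
        Real.sum_mul_le_sqrt_mul_sqrt _ _ _
    _ ≤ √α * √β := by
        simp only [mul_pow, Real.sq_sqrt (hq _)]
        gcongr
        · refine (Finset.sum_le_sum fun i _ => hr i).trans (sum_le_hasSum _ (fun i _ => ?_) hα)
          exact (mul_nonneg (hq i) (sq_nonneg _)).trans (hr i)
        · exact sum_le_hasSum _ (fun i _ => mul_nonneg (hq i) (sq_nonneg _)) hβ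

/-- Effects satisfy `A² ≤ A`. -/
theorem norm_sq_le_of_effect {L : Type*} [NormedAddCommGroup L] [InnerProductSpace ℂ L]
    {A : L →L[ℂ] L} (hA : A.IsPositive) (hA1 : ∀ u, (inner ℂ u (A u)).re ≤ ‖u‖ ^ 2) (u : L) :
    ‖A u‖ ^ 2 ≤ (inner ℂ u (A u)).re := by
  have hs : ∀ u v, inner ℂ (A u) v = inner ℂ u (A v) := hA.isSymmetric
  have h1 := hA1 (A u)
  -- Positivity at `u - Au` gives `2‖Au‖² ≤ ⟨u, Au⟩ + ⟨Au, A(Au)⟩`, and `A ≤ 1` at `Au` absorbs the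
  -- last term.
  have h2 : 0 ≤ (inner ℂ (u - A u) (A (u - A u))).re := hA.re_inner_nonneg_right _
  have h3 : (inner ℂ u (A (A u))).re = ‖A u‖ ^ 2 := by
    rw [← hs, ← inner_self_eq_norm_sq (𝕜 := ℂ)]; rfl
  simp only [map_sub, inner_sub_left, inner_sub_right, Complex.sub_re, hs] at h2
  rw [hs] at h1
  linarith

theorem norm_sub_smul_sq {K : Type*} [NormedAddCommGroup K] [InnerProductSpace ℂ K] (x y : K)
    (m : ℝ) : ‖x - (m : ℂ) • y‖ ^ 2 = ‖x‖ ^ 2 - 2 * m * (inner ℂ y x).re + m ^ 2 * ‖y‖ ^ 2 := by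
  rw [@norm_sub_sq ℂ, inner_smul_right, norm_smul, mul_pow, ← inner_conj_symm x y]
  simp only [Complex.norm_real, Real.norm_eq_abs, sq_abs, RCLike.re_eq_complex_re,
    Complex.re_ofReal_mul, Complex.conj_re]
  ring

theorem opNorm_le_one_of_effect {L : Type*} [NormedAddCommGroup L] [InnerProductSpace ℂ L]
    {A : L →L[ℂ] L} (hA : A.IsPositive) (hA1 : ∀ u, (inner ℂ u (A u)).re ≤ ‖u‖ ^ 2) : ‖A‖ ≤ 1 :=
  A.opNorm_le_bound zero_le_one fun u => by
    have := (norm_sq_le_of_effect hA hA1 u).trans (hA1 u)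
    rw [one_mul]
    exact (sq_le_sq₀ (norm_nonneg _) (norm_nonneg _)).1 this

theorem re_inner_le_opNorm {L : Type*} [NormedAddCommGroup L] [InnerProductSpace ℂ L]
    (B : L →L[ℂ] L) (u : L) : (inner ℂ u (B u)).re ≤ ‖B‖ * ‖u‖ ^ 2 := by
  calc _ ≤ ‖u‖ * ‖B u‖ := re_inner_le_norm (𝕜 := ℂ) _ _
    _ ≤ ‖u‖ * (‖B‖ * ‖u‖) := by gcongr; exact B.le_opNorm u
    _ = _ := by ring

/-- A self-adjoint `G` satisfies `G - G² ≤ 1/4`. -/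
theorem re_inner_sub_sq_le {L : Type*} [NormedAddCommGroup L] [InnerProductSpace ℂ L]
    {G : L →L[ℂ] L} (hG : ∀ u v, inner ℂ (G u) v = inner ℂ u (G v)) (u : L) :
    (inner ℂ u ((G - G ^ 2) u)).re ≤ 1 / 4 * ‖u‖ ^ 2 := by
  -- Complete the square: `1/4 - (G - G²) = (G - 1/2)²`.
  have h1 := norm_sub_smul_sq (G u) u (1 / 2)
  have h2 : (inner ℂ u (G (G u))).re = ‖G u‖ ^ 2 := by
    rw [← hG, ← inner_self_eq_norm_sq (𝕜 := ℂ)]; rfl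
  have h3 : (inner ℂ u ((G - G ^ 2) u)).re = (inner ℂ u (G u)).re - ‖G u‖ ^ 2 := by
    simp only [sq, sub_apply, mul_apply_eq_comp, inner_sub_right, Complex.sub_re]
    rw [h2, sq]
  nlinarith [sq_nonneg ‖G u - ((1 / 2 : ℝ) : ℂ) • u‖]

variable {H K : Type*} [NormedAddCommGroup H] [InnerProductSpace ℂ H]
  [NormedAddCommGroup K] [InnerProductSpace ℂ K] {ι : Type*}

/-- Here `t` is the covariance of `A` with `N_A`, and `w - m²` is the variance of `N_A` in the
mixture. The bound `κ` on `G - G²` is left free so that both `‖G - G²‖` and `1/4` can be used. -/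
theorem covariance_bound {q : ι → ℝ} {φ : ι → K} (hq : ∀ i, 0 ≤ q i) (hq1 : HasSum q 1)
    (hφ : ∀ i, ‖φ i‖ = 1) {A : HilbertTensor H K →L[ℂ] HilbertTensor H K} (hA : A.IsPositive)
    (hA1 : ∀ u, (inner ℂ u (A u)).re ≤ ‖u‖ ^ 2) {G : H →L[ℂ] H}
    (hG : ∀ ψ χ, HasSum (fun i => (q i : ℂ) * inner ℂ (tensorVec ψ (φ i)) (A (tensorVec χ (φ i))))
      (inner ℂ ψ (G χ))) (hGs : ∀ u v, inner ℂ (G u) v = inner ℂ u (G v)) {NA : K →L[ℂ] K}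
    (hNA : ∀ u v, inner ℂ (NA u) v = inner ℂ u (NA v)) {m w : ℝ}
    (hm : HasSum (fun i => q i * (inner ℂ (φ i) (NA (φ i))).re) m)
    (hw : HasSum (fun i => q i * ‖NA (φ i)‖ ^ 2) w) {κ : ℝ}
    (hκ : ∀ u, (inner ℂ u ((G - G ^ 2) u)).re ≤ κ * ‖u‖ ^ 2) (hκ0 : 0 ≤ κ) {ψ χ : H} {t : ℂ}
    (ht : HasSum (fun i => (q i : ℂ) * inner ℂ (A (tensorVec ψ (φ i)))
      (tensorVec χ (NA (φ i) - (m : ℂ) • φ i))) t) :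
    ‖t‖ ≤ √κ * √(w - m ^ 2) * ‖ψ‖ * ‖χ‖ := by
  have hAs : ∀ u v, inner ℂ (A u) v = inner ℂ u (A v) := hA.isSymmetric
  have hreal : ∀ y, ((inner ℂ y (NA y)).re : ℂ) = inner ℂ y (NA y) := fun y => by
    rw [← Complex.conj_eq_iff_re, inner_conj_symm, hNA]
  -- Since `m` is the mean of `N_A`, centring makes the `Gψ ⊗ φᵢ` contributions cancel.
  have h0 : HasSum (fun i => (q i : ℂ) * inner ℂ (tensorVec (G ψ) (φ i))
      (tensorVec χ (NA (φ i) - (m : ℂ) • φ i))) 0 := by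
    have h1 : HasSum (fun i => q i * (inner ℂ (φ i) (NA (φ i))).re - m * q i) 0 := by
      simpa using hm.sub (hq1.mul_left m)
    have h2 := (Complex.hasSum_ofReal.2 h1).mul_left (inner ℂ (G ψ) χ)
    rw [Complex.ofReal_zero, mul_zero] at h2
    refine hasSum_of_eq h2 (fun i => ?_) rfl
    rw [inner_tensorVec, inner_sub_right, inner_smul_right, inner_self_eq_norm_sq_to_K, hφ]
    push_cast
    rw [hreal]
    ring
  have hdiff : HasSum (fun i => (q i : ℂ) * inner ℂ (A (tensorVec ψ (φ i)) - tensorVec (G ψ) (φ i))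
      (tensorVec χ (NA (φ i) - (m : ℂ) • φ i))) t := by
    simpa only [inner_sub_left, mul_sub, sub_zero] using ht.sub h0
  have hβ : HasSum (fun i => q i * ‖tensorVec χ (NA (φ i) - (m : ℂ) • φ i)‖ ^ 2)
      (‖χ‖ ^ 2 * (w - m ^ 2)) := by
    have h1 := ((hw.sub (hm.mul_left (2 * m))).add (hq1.mul_left (m ^ 2))).mul_left (‖χ‖ ^ 2)
    refine hasSum_of_eq h1 (fun i => ?_) ?_
    · rw [norm_tensorVec, mul_pow, norm_sub_smul_sq, hφ]
      ring
    · ring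
  -- The summand majorises `‖A(ψ ⊗ φᵢ) - Gψ ⊗ φᵢ‖²` by `A² ≤ A`; its average is `⟨ψ, Gψ⟩ - 2‖Gψ‖² +
  -- ‖Gψ‖²`.
  have hα : HasSum (fun i => q i * ((inner ℂ (tensorVec ψ (φ i)) (A (tensorVec ψ (φ i)))).re -
      2 * (inner ℂ (tensorVec ψ (φ i)) (A (tensorVec (G ψ) (φ i)))).re + ‖G ψ‖ ^ 2))
      (inner ℂ ψ ((G - G ^ 2) ψ)).re := by
    have h1 := ((Complex.hasSum_re (hG ψ ψ)).sub
      ((Complex.hasSum_re (hG ψ (G ψ))).mul_left 2)).add (hq1.mul_left (‖G ψ‖ ^ 2))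
    refine hasSum_of_eq h1 (fun i => ?_) ?_
    · simp only [Complex.re_ofReal_mul]
      ring
    · have h2 : (inner ℂ ψ (G (G ψ))).re = ‖G ψ‖ ^ 2 := by
        rw [← hGs, ← inner_self_eq_norm_sq (𝕜 := ℂ)]; rfl
      simp only [sq, sub_apply, mul_apply_eq_comp, inner_sub_right, Complex.sub_re, h2]
      ring
  have hr : ∀ i, q i * ‖A (tensorVec ψ (φ i)) - tensorVec (G ψ) (φ i)‖ ^ 2 ≤
      q i * ((inner ℂ (tensorVec ψ (φ i)) (A (tensorVec ψ (φ i)))).re -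
      2 * (inner ℂ (tensorVec ψ (φ i)) (A (tensorVec (G ψ) (φ i)))).re + ‖G ψ‖ ^ 2) := fun i => by
    refine mul_le_mul_of_nonneg_left ?_ (hq i)
    have h1 := norm_sq_le_of_effect hA hA1 (tensorVec ψ (φ i))
    rw [@norm_sub_sq ℂ, norm_tensorVec (G ψ), hφ, mul_one, hAs]
    simp only [RCLike.re_eq_complex_re]
    linarith
  calc ‖t‖ ≤ _ := norm_le_of_hasSum_inner hq hdiff hr hα hβ
    _ ≤ √(κ * ‖ψ‖ ^ 2) * √(‖χ‖ ^ 2 * (w - m ^ 2)) := by gcongr; exact hκ ψ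
    _ = _ := by
      rw [Real.sqrt_mul hκ0, Real.sqrt_mul (sq_nonneg _),
        Real.sqrt_sq (norm_nonneg _), Real.sqrt_sq (norm_nonneg _)]
      ring

variable [CompleteSpace H] [CompleteSpace K]

theorem additive_symmetric {NS : H →L[ℂ] H} (hNS : IsSelfAdjoint NS) {NA : K →L[ℂ] K}
    (hNA : IsSelfAdjoint NA) (u v : HilbertTensor H K) :
    inner ℂ (additive NS NA u) v = inner ℂ u (additive NS NA v) := by
  have h1 : ContinuousLinearMap.adjoint (1 : H →L[ℂ] H) = 1 := ContinuousLinearMap.adjoint_id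
  have h2 : ContinuousLinearMap.adjoint (1 : K →L[ℂ] K) = 1 := ContinuousLinearMap.adjoint_id
  rw [← ContinuousLinearMap.adjoint_inner_right, additive, map_add, adjoint_tensorOp,
    adjoint_tensorOp, hNS.adjoint_eq, hNA.adjoint_eq, h1, h2]

/-- The commutator is a difference of two covariances, each controlled by `covariance_bound`; hence
the factor `2`. -/
theorem norm_commutator_le_of_ensemble {q : ι → ℝ} {φ : ι → K} (hq : ∀ i, 0 ≤ q i)
    (hq1 : HasSum q 1)
    (hφ : ∀ i, ‖φ i‖ = 1) {A : HilbertTensor H K →L[ℂ] HilbertTensor H K} (hA : A.IsPositive)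
    (hA1 : ∀ u, (inner ℂ u (A u)).re ≤ ‖u‖ ^ 2) {G : H →L[ℂ] H}
    (hG : ∀ ψ χ, HasSum (fun i => (q i : ℂ) * inner ℂ (tensorVec ψ (φ i)) (A (tensorVec χ (φ i))))
      (inner ℂ ψ (G χ))) {NS : H →L[ℂ] H} (hNS : IsSelfAdjoint NS) {NA : K →L[ℂ] K} (hNA : IsSelfAdjoint NA)
    (hAN : ⁅A, additive NS NA⁆ = 0) {m w : ℝ}
    (hm : HasSum (fun i => q i * (inner ℂ (φ i) (NA (φ i))).re) m)
    (hw : HasSum (fun i => q i * ‖NA (φ i)‖ ^ 2) w) {κ : ℝ}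
    (hκ : ∀ u, (inner ℂ u ((G - G ^ 2) u)).re ≤ κ * ‖u‖ ^ 2) (hκ0 : 0 ≤ κ) :
    ‖⁅G, NS⁆‖ ≤ 2 * √(w - m ^ 2) * √κ := by
  have hAs : ∀ u v, inner ℂ (A u) v = inner ℂ u (A v) := hA.isSymmetric
  have hGs : ∀ u v, inner ℂ (G u) v = inner ℂ u (G v) := fun u v => by
    have h1 := Complex.hasSum_conj'.2 (hG v u)
    rw [inner_conj_symm] at h1
    refine h1.unique (hasSum_of_eq (hG u v) (fun i => ?_) rfl)
    rw [map_mul, Complex.conj_ofReal, inner_conj_symm, hAs]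
  have hNSs : ∀ u v, inner ℂ (NS u) v = inner ℂ u (NS v) := hNS.isSymmetric
  have hNAs : ∀ u v, inner ℂ (NA u) v = inner ℂ u (NA v) := hNA.isSymmetric
  have hsum : ∀ ψ χ, Summable fun i => (q i : ℂ) * inner ℂ (A (tensorVec ψ (φ i)))
      (tensorVec χ (NA (φ i) - (m : ℂ) • φ i)) := fun ψ χ => by
    refine Summable.of_norm_bounded
      (hq1.summable.mul_right (‖A‖ * ‖ψ‖ * (‖χ‖ * (‖NA‖ + |m|)))) fun i => ?_
    rw [norm_mul, Complex.norm_real, Real.norm_of_nonneg (hq i)]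
    refine mul_le_mul_of_nonneg_left ((norm_inner_le_norm _ _).trans ?_) (hq i)
    have h1 : ‖A (tensorVec ψ (φ i))‖ ≤ ‖A‖ * ‖ψ‖ := by
      simpa [norm_tensorVec, hφ] using A.le_opNorm (tensorVec ψ (φ i))
    have h2 : ‖NA (φ i) - (m : ℂ) • φ i‖ ≤ ‖NA‖ + |m| := by
      refine (norm_sub_le _ _).trans (add_le_add ?_ ?_)
      · simpa [hφ] using NA.le_opNorm (φ i)
      · simp [norm_smul, hφ]
    rw [norm_tensorVec]
    gcongr
  -- Conservation of `N` trades `N_S` for `N_A` with opposite sign; the shift by the real number `m`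
  -- cancels between the two terms.
  have hcomm : ∀ ψ χ i, inner ℂ (tensorVec ψ (φ i)) (A (tensorVec (NS χ) (φ i))) -
      inner ℂ (tensorVec (NS ψ) (φ i)) (A (tensorVec χ (φ i))) =
      starRingEnd ℂ (inner ℂ (A (tensorVec χ (φ i))) (tensorVec ψ (NA (φ i) - (m : ℂ) • φ i))) -
      inner ℂ (A (tensorVec ψ (φ i))) (tensorVec χ (NA (φ i) - (m : ℂ) • φ i)) := by
    intro ψ χ i
    have h1 : ∀ u, A (additive NS NA u) = additive NS NA (A u) := fun u =>
      sub_eq_zero.1 (DFunLike.congr_fun hAN u)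
    have h2 : ∀ ψ y, additive NS NA (tensorVec ψ y) = tensorVec (NS ψ) y + tensorVec ψ (NA y) :=
      fun ψ y => by simp [additive, tensorOp_tensorVec]
    have h3 := additive_symmetric hNS hNA (tensorVec ψ (φ i)) (A (tensorVec χ (φ i)))
    rw [← h1, h2, h2, map_add, inner_add_left, inner_add_right] at h3
    rw [inner_conj_symm, tensorVec_sub_right, tensorVec_sub_right, tensorVec_smul_right,
      tensorVec_smul_right, inner_sub_left, inner_sub_right, inner_smul_left, inner_smul_right,
      Complex.conj_ofReal, hAs, hAs]
    linear_combination -h3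
  refine ContinuousLinearMap.opNorm_le_of_re_inner_le (by positivity) fun χ ψ hχ hψ => ?_
  have h1 := (hG ψ (NS χ)).sub (hG (NS ψ) χ)
  have h2 := (Complex.hasSum_conj'.2 (hsum χ ψ).hasSum).sub (hsum ψ χ).hasSum
  have h3 := h1.unique (hasSum_of_eq h2 (fun i => by
    rw [← mul_sub, hcomm, map_mul, Complex.conj_ofReal, mul_sub]) rfl)
  have h4 : inner ℂ ψ (⁅G, NS⁆ χ) = inner ℂ ψ (G (NS χ)) - inner ℂ (NS ψ) (G χ) := by
    rw [hNSs, ← inner_sub_right]; rfl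
  rw [← inner_re_symm, h4, h3]
  refine (Complex.re_le_norm _).trans ((norm_sub_le _ _).trans ?_)
  have h5 := covariance_bound hq hq1 hφ hA hA1 hG hGs hNAs hm hw hκ hκ0 (hsum χ ψ).hasSum
  have h6 := covariance_bound hq hq1 hφ hA hA1 hG hGs hNAs hm hw hκ hκ0 (hsum ψ χ).hasSum
  rw [hχ, hψ, mul_one, mul_one] at h5 h6
  rw [RCLike.norm_conj]
  linarith

end Covariance

/-! ### Convexity of observables and extremality. -/

section Observable

variable {H X : Type*} [NormedAddCommGroup H] [InnerProductSpace ℂ H]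

theorem inner_polarization (T : H →L[ℂ] H) (x y : H) :
    inner ℂ x (T y) = (inner ℂ (x + y) (T (x + y)) - inner ℂ (x - y) (T (x - y))
      - Complex.I * inner ℂ (x + Complex.I • y) (T (x + Complex.I • y))
      + Complex.I * inner ℂ (x - Complex.I • y) (T (x - Complex.I • y))) / 4 := by
  simp only [map_add, map_sub, map_smul, inner_add_left, inner_add_right, inner_sub_left,
    inner_sub_right, inner_smul_left, inner_smul_right, Complex.conj_I]
  linear_combination (1 / 2 * inner ℂ x (T y) - 1 / 2 * inner ℂ y (T x)) * Complex.I_sq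

/-- The normalisation of an observable may be tested on the diagonal. -/
theorem isObservable_of_diag {E : X → (H →L[ℂ] H)} (h0 : ∀ x u, (0 : ℂ) ≤ inner ℂ u (E x u))
    (h1 : ∀ u, HasSum (fun x => inner ℂ u (E x u)) (inner ℂ u u)) : IsObservable E where
  positive x := isPositive_of_inner_nonneg (h0 x)
  sum_eq_one φ ψ := by
    have h2 := ((((h1 (φ + ψ)).sub (h1 (φ - ψ))).sub
      ((h1 (φ + Complex.I • ψ)).mul_left Complex.I)).add
      ((h1 (φ - Complex.I • ψ)).mul_left Complex.I)).div_const 4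
    exact hasSum_of_eq h2 (fun x => inner_polarization (E x) φ ψ)
      (inner_polarization (1 : H →L[ℂ] H) φ ψ)

/-- An extremal observable equals every observable of which it dominates a positive multiple. -/
theorem IsExtremalObservable.eq_of_smul_le {E F : X → (H →L[ℂ] H)} (hE : IsExtremalObservable E)
    (hF : IsObservable F) {c : ℝ} (hc : 0 < c) (hc1 : c ≤ 1)
    (hle : ∀ x u, (c : ℂ) * inner ℂ u (F x u) ≤ inner ℂ u (E x u)) : F = E := by
  have hEobs : IsObservable E := hE.1
  have hd : (1 - c / 2 : ℝ) ≠ 0 := by linarith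
  have hdc : (2 - c : ℂ) ≠ 0 := by
    exact_mod_cast (by linarith : (2 - c : ℝ) ≠ 0)
  -- `R` solves `E = (c/2) F + (1 - c/2) R`. Using `c/2` instead of `c` keeps both weights strictly
  -- positive even when `c = 1`.
  set R : X → (H →L[ℂ] H) := fun x => (1 - c / 2)⁻¹ • (E x - (c / 2) • F x) with hR
  have hRinner : ∀ x u, inner ℂ u (R x u) =
      ((1 - c / 2 : ℝ)⁻¹ : ℝ) * (inner ℂ u (E x u) - (c / 2 : ℝ) * inner ℂ u (F x u)) := by
    intro x u
    simp only [hR, smul_apply, sub_apply, RCLike.real_smul_eq_coe_smul (K := ℂ), inner_smul_right,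
      inner_sub_right]
    rfl
  have hRobs : IsObservable R := by
    refine isObservable_of_diag (fun x u => ?_) fun u => ?_
    · rw [hRinner]
      have h1 : (0 : ℂ) ≤ inner ℂ u (F x u) := (hF.positive x).inner_nonneg_right u
      have h2 := hle x u
      refine mul_nonneg (by rw [Complex.zero_le_real]; exact inv_nonneg.2 (by linarith)) ?_
      rw [sub_nonneg]
      refine le_trans ?_ h2
      refine mul_le_mul_of_nonneg_right ?_ h1
      rw [Complex.real_le_real]
      linarith
    · refine hasSum_of_eq (((hEobs.sum_eq_one u u).sub
        ((hF.sum_eq_one u u).mul_left ((c / 2 : ℝ) : ℂ))).mul_left (((1 - c / 2 : ℝ)⁻¹ : ℝ) : ℂ))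
        (fun x => hRinner x u) ?_
      push_cast
      field_simp
  refine hE.2 hF hRobs ⟨c / 2, 1 - c / 2, by linarith, by linarith, by ring, ?_⟩
  funext x
  simp only [hR, Pi.add_apply, Pi.smul_apply, smul_smul]
  rw [mul_inv_cancel₀ hd, one_smul]
  abel

end Observable

/-! ### Pure-state ensembles, variance and Fisher information. -/

section Ensemble

variable {H K X : Type*} [NormedAddCommGroup H] [InnerProductSpace ℂ H] [CompleteSpace H]
  [NormedAddCommGroup K] [InnerProductSpace ℂ K] [CompleteSpace K]

omit [CompleteSpace K] in
theorem IsPureEnsemble.hasSum_inner_restriction {ξ : K →L[ℂ] K} {q : ℕ → ℝ} {φ : ℕ → K}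
    (h : IsPureEnsemble ξ q φ) (hξ : IsTraceClass ξ)
    (B : HilbertTensor H K →L[ℂ] HilbertTensor H K) (ψ χ : H) :
    HasSum (fun i => (q i : ℂ) * inner ℂ (tensorVec ψ (φ i)) (B (tensorVec χ (φ i))))
      (inner ℂ ψ (restriction H ξ hξ B χ)) := by
  have := (innerSL ℂ ψ).hasSum ((ContinuousLinearMap.apply ℂ H χ).hasSum
    (h.hasSum_restriction hξ B))
  refine hasSum_of_eq this (fun i => ?_) rfl
  rw [← inner_compress, ← inner_smul_right]
  rfl

omit [CompleteSpace K] in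
/-- If the restrictions of the effects `A(x)` to a mixture of pure states form an observable, then
so do their restrictions to each of the pure states. -/
theorem IsPureEnsemble.isObservable_compress {ξ : K →L[ℂ] K} {q : ℕ → ℝ} {φ : ℕ → K}
    (h : IsPureEnsemble ξ q φ) (hξ : IsTraceClass ξ)
    {A : X → (HilbertTensor H K →L[ℂ] HilbertTensor H K)}
    (hA : ∀ x u, (0 : ℂ) ≤ inner ℂ u (A x u))
    (hA1 : ∀ u (F : Finset X), ∑ x ∈ F, inner ℂ u (A x u) ≤ inner ℂ u u)
    (hobs : IsObservable fun x => restriction H ξ hξ (A x)) {i : ℕ} (hi : 0 < q i) :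
    IsObservable fun x => compress (H := H) (φ i) (A x) := by
  refine isObservable_of_diag (fun x u => ?_) fun u => ?_
  · rw [inner_compress]
    exact hA x _
  simp only [inner_compress]
  have hnorm : ∀ j, inner ℂ (tensorVec u (φ j)) (tensorVec u (φ j)) = (inner ℂ u u : ℂ) := by
    intro j
    rw [inner_tensorVec, inner_self_eq_norm_sq_to_K (φ j), h.norm_eq_one]
    simp
  have hq1 : HasSum (fun j => (q j : ℂ)) 1 := by
    have := Complex.hasSum_ofReal.2 h.sum_eq_one
    rwa [Complex.ofReal_one] at this
  have hgap : ∀ (F : Finset X) j, (0 : ℂ) ≤ (q j : ℂ) * (inner ℂ u u -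
      ∑ x ∈ F, inner ℂ (tensorVec u (φ j)) (A x (tensorVec u (φ j)))) := by
    intro F j
    refine mul_nonneg (Complex.zero_le_real.2 (h.nonneg j)) (sub_nonneg.2 ?_)
    rw [← hnorm j]
    exact hA1 _ F
  -- The normalisation deficit of the mixture is the average of nonnegative pure-state deficits. It
  -- tends to zero, so each deficit of positive weight is squeezed to zero.
  have hle : ∀ F : Finset X, (q i : ℂ) * (inner ℂ u u -
      ∑ x ∈ F, inner ℂ (tensorVec u (φ i)) (A x (tensorVec u (φ i)))) ≤
      inner ℂ u u - ∑ x ∈ F, inner ℂ u (restriction H ξ hξ (A x) u) := by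
    intro F
    refine le_hasSum (hasSum_of_eq ((hq1.mul_right (inner ℂ u u : ℂ)).sub
      (hasSum_sum (s := F) fun x _ => h.hasSum_inner_restriction hξ (A x) u u)) (fun j => ?_) ?_) i
      (fun j _ => hgap F j)
    · rw [mul_sub, Finset.mul_sum]
    · rw [one_mul]
  have h1 : Filter.Tendsto (fun F : Finset X => (inner ℂ u u : ℂ) -
      ∑ x ∈ F, inner ℂ u (restriction H ξ hξ (A x) u)) Filter.atTop (nhds 0) := by
    have : HasSum _ _ := hobs.sum_eq_one u u
    simpa using Filter.Tendsto.const_sub (inner ℂ u u : ℂ) this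
  have h2 : Filter.Tendsto (fun F : Finset X => (q i : ℂ) * (inner ℂ u u -
      ∑ x ∈ F, inner ℂ (tensorVec u (φ i)) (A x (tensorVec u (φ i))))) Filter.atTop (nhds 0) :=
    squeeze_zero_norm (fun F => CStarAlgebra.norm_le_norm_of_nonneg_of_le (hgap F i) (hle F))
      (by simpa using h1.norm)
  have hqi : (q i : ℂ) ≠ 0 := by exact_mod_cast hi.ne'
  have h3 := (h2.const_mul ((q i : ℂ)⁻¹)).const_sub (inner ℂ u u : ℂ)
  simp only [inv_mul_cancel_left₀ hqi, sub_sub_cancel, mul_zero, sub_zero] at h3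
  exact h3

theorem IsPureEnsemble.variance_eq {ξ : K →L[ℂ] K} {q : ℕ → ℝ} {φ : ℕ → K}
    (h : IsPureEnsemble ξ q φ) {N : K →L[ℂ] K} (hN : IsSelfAdjoint N) :
    ∃ m w, HasSum (fun i => q i * (inner ℂ (φ i) (N (φ i))).re) m ∧
      HasSum (fun i => q i * ‖N (φ i)‖ ^ 2) w ∧ variance N ξ = w - m ^ 2 := by
  have hs : ∀ u v, inner ℂ (N u) v = inner ℂ u (N v) := hN.isSymmetric
  refine ⟨_, _, ?_, ?_, rfl⟩
  · refine hasSum_of_eq (Complex.hasSum_re (trace_mul N h.summable h.hasSum_rankOne))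
      (fun i => ?_) rfl
    rw [map_smul, inner_smul_right, Complex.re_ofReal_mul]
  · refine hasSum_of_eq (Complex.hasSum_re (trace_mul (N ^ 2) h.summable h.hasSum_rankOne))
      (fun i => ?_) rfl
    rw [map_smul, inner_smul_right, Complex.re_ofReal_mul, ← inner_self_eq_norm_sq (𝕜 := ℂ),
      sq, mul_apply_eq_comp, ← hs (φ i) (N (φ i))]
    rfl

theorem variance_rankOne {N : K →L[ℂ] K} (hN : IsSelfAdjoint N) (φ : K) :
    variance N (InnerProductSpace.rankOne ℂ φ φ) = ‖N φ‖ ^ 2 - (inner ℂ φ (N φ)).re ^ 2 := by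
  have hs : ∀ u v, inner ℂ (N u) v = inner ℂ u (N v) := hN.isSymmetric
  rw [variance, trace_mul_rankOne, trace_mul_rankOne, ← inner_self_eq_norm_sq (𝕜 := ℂ) (N φ), sq N,
    mul_apply_eq_comp, ← hs]
  rfl

theorem variance_rankOne_nonneg {N : K →L[ℂ] K} (hN : IsSelfAdjoint N) {φ : K} (hφ : ‖φ‖ = 1) :
    0 ≤ variance N (InnerProductSpace.rankOne ℂ φ φ) := by
  rw [variance_rankOne hN, sub_nonneg]
  refine sq_le_sq' ?_ ?_
  · have := re_inner_le_norm (𝕜 := ℂ) (-φ) (N φ)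
    simp [hφ] at this
    linarith
  · simpa [hφ] using re_inner_le_norm (𝕜 := ℂ) φ (N φ)

theorem IsPureEnsemble.summable_variance {ξ : K →L[ℂ] K} {q : ℕ → ℝ} {φ : ℕ → K}
    (h : IsPureEnsemble ξ q φ) {N : K →L[ℂ] K} (hN : IsSelfAdjoint N) :
    Summable fun i => q i * variance N (InnerProductSpace.rankOne ℂ (φ i) (φ i)) := by
  obtain ⟨m, w, -, hw, -⟩ := h.variance_eq hN
  refine hw.summable.of_nonneg_of_le
    (fun i => mul_nonneg (h.nonneg i) (variance_rankOne_nonneg hN (h.norm_eq_one i))) fun i => ?_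
  rw [variance_rankOne hN]
  exact mul_le_mul_of_nonneg_left (sub_le_self _ (sq_nonneg _)) (h.nonneg i)

/-- A lower bound for the averaged variance of all ensembles bounds the Fisher information. -/
theorem IsState.le_fisherInformation [TopologicalSpace.SeparableSpace K] {ξ : K →L[ℂ] K}
    (hξ : IsState ξ) {N : K →L[ℂ] K} {c : ℝ}
    (hc : ∀ (q : ℕ → ℝ) (φ : ℕ → K), IsPureEnsemble ξ q φ →
      c ≤ 4 * ∑' i, q i * variance N (InnerProductSpace.rankOne ℂ (φ i) (φ i))) :
    c ≤ fisherInformation N ξ := by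
  -- An ensemble must exist: the infimum of an empty set of reals is `0` by convention, which would
  -- break the lower bound.
  obtain ⟨q, φ, h⟩ := hξ.exists_isPureEnsemble
  have : c / 4 ≤ sInf {v : ℝ | ∃ (q : ℕ → ℝ) (φ : ℕ → K), IsPureEnsemble ξ q φ ∧
      v = ∑' i, q i * variance N (InnerProductSpace.rankOne ℂ (φ i) (φ i))} := by
    refine le_csInf ⟨_, q, φ, h, rfl⟩ ?_
    rintro v ⟨q, φ, h, rfl⟩
    linarith [hc q φ h]
  rw [fisherInformation]
  linarith

/-- The commutator bound for a pure state of the apparatus. -/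
theorem norm_commutator_compress_le {φ : K} (hφ : ‖φ‖ = 1)
    {A : HilbertTensor H K →L[ℂ] HilbertTensor H K} (hA : A.IsPositive)
    (hA1 : ∀ u, (inner ℂ u (A u)).re ≤ ‖u‖ ^ 2) {NS : H →L[ℂ] H} (hNS : IsSelfAdjoint NS)
    {NA : K →L[ℂ] K} (hNA : IsSelfAdjoint NA) (hAN : ⁅A, additive NS NA⁆ = 0) {κ : ℝ}
    (hκ : ∀ u, (inner ℂ u ((compress φ A - compress φ A ^ 2) u)).re ≤ κ * ‖u‖ ^ 2) (hκ0 : 0 ≤ κ) :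
    ‖⁅compress φ A, NS⁆‖ ≤ 2 * √(variance NA (InnerProductSpace.rankOne ℂ φ φ)) * √κ := by
  rw [variance_rankOne hNA]
  exact norm_commutator_le_of_ensemble (ι := Unit) (q := fun _ => 1) (φ := fun _ => φ)
    (fun _ => zero_le_one) (hasSum_unique _) (fun _ => hφ) hA hA1
    (fun ψ χ => hasSum_of_eq (hasSum_unique fun _ : Unit => inner ℂ ψ (compress φ A χ))
      (fun _ => by simp [inner_compress]) rfl) hNS hNA hAN
    (hasSum_of_eq (hasSum_unique fun _ : Unit => (inner ℂ φ (NA φ)).re) (fun _ => one_mul _) rfl)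
    (hasSum_of_eq (hasSum_unique fun _ : Unit => ‖NA φ‖ ^ 2) (fun _ => one_mul _) rfl) hκ hκ0

/-- The commutator bound for a mixture of pure states of the apparatus. -/
theorem IsPureEnsemble.norm_commutator_sq_le {ξ : K →L[ℂ] K} {q : ℕ → ℝ} {φ : ℕ → K}
    (h : IsPureEnsemble ξ q φ) (hξ : IsTraceClass ξ)
    {A : HilbertTensor H K →L[ℂ] HilbertTensor H K} (hA : A.IsPositive)
    (hA1 : ∀ u, (inner ℂ u (A u)).re ≤ ‖u‖ ^ 2) {NS : H →L[ℂ] H} (hNS : IsSelfAdjoint NS)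
    {NA : K →L[ℂ] K} (hNA : IsSelfAdjoint NA) (hAN : ⁅A, additive NS NA⁆ = 0) :
    ‖⁅restriction H ξ hξ A, NS⁆‖ ^ 2 ≤
      ∑' i, q i * variance NA (InnerProductSpace.rankOne ℂ (φ i) (φ i)) := by
  set v : ℕ → ℝ := fun i => variance NA (InnerProductSpace.rankOne ℂ (φ i) (φ i)) with hv
  have hv0 : ∀ i, 0 ≤ v i := fun i => variance_rankOne_nonneg hNA (h.norm_eq_one i)
  have hAs : ∀ u v, inner ℂ (A u) v = inner ℂ u (A v) := hA.isSymmetric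
  -- Taking `κ = 1/4` contributes `√κ = 1/2`, which cancels the factor `2`.
  have hpure : ∀ i, ‖⁅compress (H := H) (φ i) A, NS⁆‖ ≤ √(v i) := by
    intro i
    have hs : ∀ u v, inner ℂ (compress (φ i) A u) v = inner ℂ u (compress (φ i) A v) :=
      fun u v => by rw [← inner_conj_symm, inner_compress, inner_compress, inner_conj_symm, hAs]
    have := norm_commutator_compress_le (h.norm_eq_one i) hA hA1 hNS hNA hAN
      (re_inner_sub_sq_le hs) (by norm_num)
    have h4 : √(1 / 4 : ℝ) = 1 / 2 := by
      rw [show (1 / 4 : ℝ) = (1 / 2) ^ 2 by norm_num, Real.sqrt_sq (by norm_num)]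
    rw [h4] at this
    linarith
  have hsum : HasSum (fun i => (q i : ℂ) • ⁅compress (H := H) (φ i) A, NS⁆)
      ⁅restriction H ξ hξ A, NS⁆ := by
    have h1 := h.hasSum_restriction (H := H) hξ A
    refine hasSum_of_eq ((h1.mul_right NS).sub (h1.mul_left NS)) (fun i => ?_) rfl
    rw [Ring.lie_def, smul_sub, smul_mul_assoc, mul_smul_comm]
  have hVs : HasSum (fun i => q i * v i) (∑' i, q i * v i) := (h.summable_variance hNA).hasSum
  have hV0 : 0 ≤ ∑' i, q i * v i := tsum_nonneg fun i => mul_nonneg (h.nonneg i) (hv0 i)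
  -- Concavity of the square root, as Cauchy–Schwarz with `qᵢ = √qᵢ √qᵢ`.
  have hle : ‖⁅restriction H ξ hξ A, NS⁆‖ ≤ √(∑' i, q i * v i) := by
    refine le_of_tendsto hsum.norm (Filter.Eventually.of_forall fun s => ?_)
    calc _ ≤ ∑ i ∈ s, √(q i) * (√(q i) * √(v i)) := by
          refine norm_sum_le_of_le _ fun i _ => ?_
          rw [norm_smul, Complex.norm_real, Real.norm_of_nonneg (h.nonneg i), ← mul_assoc,
            Real.mul_self_sqrt (h.nonneg i)]
          exact mul_le_mul_of_nonneg_left (hpure i) (h.nonneg i)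
      _ ≤ √(∑ i ∈ s, √(q i) ^ 2) * √(∑ i ∈ s, (√(q i) * √(v i)) ^ 2) :=
          Real.sum_mul_le_sqrt_mul_sqrt _ _ _
      _ ≤ √1 * √(∑' i, q i * v i) := by
          simp only [mul_pow, Real.sq_sqrt (h.nonneg _), Real.sq_sqrt (hv0 _)]
          gcongr
          · exact sum_le_hasSum _ (fun i _ => h.nonneg i) h.sum_eq_one
          · exact sum_le_hasSum _ (fun i _ => mul_nonneg (h.nonneg i) (hv0 i)) hVs
      _ = _ := by rw [Real.sqrt_one, one_mul]
  calc _ ≤ √(∑' i, q i * v i) ^ 2 := by gcongr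
    _ = _ := Real.sq_sqrt hV0

end Ensemble

/-! ### The commutator bounds for measurement schemes. -/

section Bounds

variable {HS HA X : Type*}
  [NormedAddCommGroup HS] [InnerProductSpace ℂ HS] [CompleteSpace HS]
  [NormedAddCommGroup HA] [InnerProductSpace ℂ HA] [CompleteSpace HA]

/-- Write `G - G² = (G - E)(1 - G) - E(G - E) + (E - E²)`; `1 - G` and `E` are contractions. -/
theorem norm_sub_sq_le_of_effects {L : Type*} [NormedAddCommGroup L] [InnerProductSpace ℂ L]
    {E G : L →L[ℂ] L} (hE : ‖E‖ ≤ 1) (hG : ‖1 - G‖ ≤ 1) :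
    ‖G - G ^ 2‖ ≤ 2 * ‖G - E‖ + ‖E - E ^ 2‖ := by
  have h : G - G ^ 2 = (G - E) * (1 - G) - E * (G - E) + (E - E ^ 2) := by noncomm_ring
  have h1 : ‖(G - E) * (1 - G)‖ ≤ ‖G - E‖ :=
    (norm_mul_le _ _).trans (mul_le_of_le_one_right (norm_nonneg _) hG)
  have h2 : ‖E * (G - E)‖ ≤ ‖G - E‖ :=
    (norm_mul_le _ _).trans (mul_le_of_le_one_left (norm_nonneg _) hE)
  rw [h]
  linarith [norm_add_le ((G - E) * (1 - G) - E * (G - E)) (E - E ^ 2),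
    norm_sub_le ((G - E) * (1 - G)) (E * (G - E))]

theorem norm_commutator_le_add {L : Type*} [NormedAddCommGroup L] [InnerProductSpace ℂ L]
    (E G N : L →L[ℂ] L) : ‖⁅E, N⁆‖ ≤ 2 * ‖N‖ * ‖G - E‖ + ‖⁅G, N⁆‖ := by
  have h : ⁅E, N⁆ = ⁅G, N⁆ - ((G - E) * N - N * (G - E)) := by
    rw [Ring.lie_def, Ring.lie_def]
    noncomm_ring
  rw [h]
  linarith [norm_sub_le ⁅G, N⁆ ((G - E) * N - N * (G - E)),
    norm_sub_le ((G - E) * N) (N * (G - E)), norm_mul_le (G - E) N, norm_mul_le N (G - E)]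

theorem MeasurementScheme.isPositive_evolvedPointer (M : MeasurementScheme HS HA X) (x : X) :
    (M.evolvedPointer x).IsPositive :=
  isPositive_of_inner_nonneg fun u => (M.evolvedPointer_bounds u).1 x

theorem MeasurementScheme.evolvedPointer_le_one (M : MeasurementScheme HS HA X) (x : X)
    (u : HilbertTensor HS HA) : (inner ℂ u (M.evolvedPointer x u)).re ≤ ‖u‖ ^ 2 := by
  have h := (Complex.le_def.1 ((M.evolvedPointer_bounds u).2 {x})).1
  rw [Finset.sum_singleton] at h
  exact h.trans_eq (inner_self_eq_norm_sq (𝕜 := ℂ) u)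

variable [TopologicalSpace.SeparableSpace HA]

/-- Both properties pass from the evolved pointer to its average over slices. -/
theorem MeasurementScheme.measured_bounds (M : MeasurementScheme HS HA X) (x : X) :
    (M.measured x).IsPositive ∧ (1 - M.measured x).IsPositive := by
  obtain ⟨q, φ, h⟩ := M.isState.exists_isPureEnsemble
  have hG : ∀ u, HasSum _ (inner ℂ u (M.measured x u)) := fun u =>
    h.hasSum_inner_restriction M.isState.traceClass (M.evolvedPointer x) u u
  have hq1 : HasSum (fun j => (q j : ℂ)) 1 := by
    have := Complex.hasSum_ofReal.2 h.sum_eq_one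
    rwa [Complex.ofReal_one] at this
  have hq : ∀ i, (0 : ℂ) ≤ q i := fun i => Complex.zero_le_real.2 (h.nonneg i)
  refine ⟨isPositive_of_inner_nonneg fun u => (hG u).nonneg fun i =>
    mul_nonneg (hq i) ((M.evolvedPointer_bounds _).1 x), isPositive_of_inner_nonneg fun u => ?_⟩
  have h1 := hasSum_le (fun i => ?_) (hG u) (hq1.mul_right (inner ℂ u u : ℂ))
  · rw [sub_apply, inner_sub_right, sub_nonneg]
    simpa using h1
  · have h2 := (M.evolvedPointer_bounds (tensorVec u (φ i))).2 {x}
    rw [Finset.sum_singleton, inner_tensorVec, inner_self_eq_norm_sq_to_K (φ i),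
      h.norm_eq_one] at h2
    refine mul_le_mul_of_nonneg_left (h2.trans_eq ?_) (hq i)
    simp

theorem opNorm_le_one_of_isPositive {L : Type*} [NormedAddCommGroup L] [InnerProductSpace ℂ L]
    {A : L →L[ℂ] L} (hA : A.IsPositive) (hA1 : (1 - A).IsPositive) : ‖A‖ ≤ 1 := by
  refine opNorm_le_one_of_effect hA fun u => ?_
  have h := hA1.re_inner_nonneg_right u
  rw [sub_apply, inner_sub_right, map_sub, sub_nonneg] at h
  exact h.trans_eq (inner_self_eq_norm_sq (𝕜 := ℂ) u)

omit [CompleteSpace HS] in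
theorem IsObservable.opNorm_le_one {E : X → (HS →L[ℂ] HS)} (hE : IsObservable E) (x : X) :
    ‖E x‖ ≤ 1 := by
  refine opNorm_le_one_of_isPositive (hE.positive x) (isPositive_of_inner_nonneg fun u => ?_)
  have := hE.sum_le {x} u
  rw [Finset.sum_singleton] at this
  simpa [inner_sub_right] using this

variable (M : MeasurementScheme HS HA X) {E : X → (HS →L[ℂ] HS)}
  {NS : HS →L[ℂ] HS} {NA : HA →L[ℂ] HA}

theorem MeasurementScheme.norm_commutator_le_variance (hE : IsObservable E)
    (hNS : IsSelfAdjoint NS) (hNA : IsSelfAdjoint NA) (hWY : M.WeakYanase NS NA) (x : X) :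
    ‖⁅E x, NS⁆‖ ≤ 2 * ‖NS‖ * ‖M.error E x‖
      + 2 * √(variance NA M.ξ) * √(2 * ‖M.error E x‖ + ‖E x - E x ^ 2‖) := by
  obtain ⟨q, φ, h⟩ := M.isState.exists_isPureEnsemble
  obtain ⟨m, w, hm, hw, hvar⟩ := h.variance_eq hNA
  have h1 : ‖⁅M.measured x, NS⁆‖ ≤ 2 * √(w - m ^ 2) * √‖M.measured x - M.measured x ^ 2‖ :=
    norm_commutator_le_of_ensemble h.nonneg h.sum_eq_one h.norm_eq_one
      (M.isPositive_evolvedPointer x) (M.evolvedPointer_le_one x)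
      (h.hasSum_inner_restriction M.isState.traceClass (M.evolvedPointer x)) hNS hNA (hWY x) hm hw
      (re_inner_le_opNorm _) (norm_nonneg _)
  obtain ⟨hG0, hG1⟩ := M.measured_bounds x
  have h2 : ‖M.measured x - M.measured x ^ 2‖ ≤ 2 * ‖M.error E x‖ + ‖E x - E x ^ 2‖ :=
    norm_sub_sq_le_of_effects (hE.opNorm_le_one x)
      (opNorm_le_one_of_isPositive hG1 (by rwa [sub_sub_cancel]))
  refine (norm_commutator_le_add (E x) (M.measured x) NS).trans ?_
  rw [hvar]
  gcongr
  · rfl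
  · exact h1.trans (by gcongr)

theorem MeasurementScheme.norm_commutator_le_fisherInformation
    (hNS : IsSelfAdjoint NS) (hNA : IsSelfAdjoint NA) (hWY : M.WeakYanase NS NA) (x : X) :
    ‖⁅E x, NS⁆‖ ≤ 2 * ‖NS‖ * ‖M.error E x‖ + 1 / 2 * √(fisherInformation NA M.ξ) := by
  -- The `2` inside the square matches the `4` in the Fisher information and becomes the final
  -- `1/2`.
  have h1 : (2 * ‖⁅M.measured x, NS⁆‖) ^ 2 ≤ fisherInformation NA M.ξ := by
    refine M.isState.le_fisherInformation fun q φ h => ?_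
    have : ‖⁅M.measured x, NS⁆‖ ^ 2 ≤ _ := h.norm_commutator_sq_le M.isState.traceClass
      (M.isPositive_evolvedPointer x) (M.evolvedPointer_le_one x) hNS hNA (hWY x)
    linarith
  have h2 := Real.le_sqrt_of_sq_le h1
  refine (norm_commutator_le_add (E x) (M.measured x) NS).trans (add_le_add le_rfl ?_)
  linarith

-- `E` dominates `qᵢ` times the observable measured with `φᵢ`, so extremality forces the two
-- observables to coincide.
omit [TopologicalSpace.SeparableSpace HA] in
theorem MeasurementScheme.compress_eq_of_isExtremal (hE : IsExtremalObservable E)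
    (hM : M.Measures E) {q : ℕ → ℝ} {φ : ℕ → HA} (h : IsPureEnsemble M.ξ q φ) {i : ℕ}
    (hi : 0 < q i) (x : X) : compress (φ i) (M.evolvedPointer x) = E x := by
  have hobs : IsObservable M.measured := by
    rw [(funext hM : M.measured = E)]
    exact hE.1
  have hF := h.isObservable_compress M.isState.traceClass
    (fun x u => (M.evolvedPointer_bounds u).1 x) (fun u F => (M.evolvedPointer_bounds u).2 F)
    hobs hi
  refine congrFun (hE.eq_of_smul_le hF hi ?_ fun x u => ?_) x
  · exact le_hasSum h.sum_eq_one i fun j _ => h.nonneg j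
  · rw [inner_compress, ← hM x]
    exact le_hasSum (h.hasSum_inner_restriction M.isState.traceClass (M.evolvedPointer x) u u) i
      fun j _ => mul_nonneg (Complex.zero_le_real.2 (h.nonneg j)) ((M.evolvedPointer_bounds _).1 x)

theorem MeasurementScheme.norm_commutator_le_of_isExtremal (hE : IsExtremalObservable E)
    (hM : M.Measures E) (hNS : IsSelfAdjoint NS) (hNA : IsSelfAdjoint NA)
    (hWY : M.WeakYanase NS NA) (x : X) :
    ‖⁅E x, NS⁆‖ ≤ √(fisherInformation NA M.ξ) * √‖E x - E x ^ 2‖ := by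
  set κ := ‖E x - E x ^ 2‖ with hκ
  set c := ‖⁅E x, NS⁆‖ with hc
  have hκ0 : 0 ≤ κ := norm_nonneg _
  -- Average the squared pure-state bounds. Extremality says nothing about indices of weight zero,
  -- but they contribute nothing.
  have key : ∀ (q : ℕ → ℝ) (φ : ℕ → HA), IsPureEnsemble M.ξ q φ →
      c ^ 2 ≤ 4 * κ * ∑' i, q i * variance NA (InnerProductSpace.rankOne ℂ (φ i) (φ i)) := by
    intro q φ h
    refine hasSum_le (fun i => ?_) (h.sum_eq_one.mul_right (c ^ 2) |> fun t => by
      rwa [one_mul] at t) ((h.summable_variance hNA).hasSum.mul_left (4 * κ))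
    rcases (h.nonneg i).eq_or_lt with hi | hi
    · simp [← hi]
    have hv := variance_rankOne_nonneg hNA (h.norm_eq_one i)
    have hEi := M.compress_eq_of_isExtremal hE hM h hi x
    have h1 := norm_commutator_compress_le (h.norm_eq_one i) (M.isPositive_evolvedPointer x)
      (M.evolvedPointer_le_one x) hNS hNA (hWY x) (κ := κ) (by
        rw [hEi]; exact re_inner_le_opNorm _) hκ0
    rw [hEi] at h1
    calc q i * c ^ 2 ≤ q i * (2 * √(variance NA (InnerProductSpace.rankOne ℂ (φ i) (φ i))) *
          √κ) ^ 2 := mul_le_mul_of_nonneg_left (by gcongr) hi.le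
      _ = _ := by
        rw [mul_pow, mul_pow, Real.sq_sqrt hv, Real.sq_sqrt hκ0]
        ring
  -- The infimum over ensembles is reached by dividing by `κ`; when `κ = 0`, a single ensemble
  -- already gives `c = 0`.
  rcases hκ0.eq_or_lt with h0 | h0
  · obtain ⟨q, φ, h⟩ := M.isState.exists_isPureEnsemble
    have h1 := key q φ h
    rw [← h0, mul_zero, zero_mul] at h1
    rw [← h0, Real.sqrt_zero, mul_zero]
    nlinarith
  · have h1 : c ^ 2 / κ ≤ fisherInformation NA M.ξ := by
      refine M.isState.le_fisherInformation fun q φ h => ?_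
      rw [div_le_iff₀ h0]
      linarith [key q φ h]
    rw [div_le_iff₀ h0] at h1
    rw [← Real.sqrt_mul' _ hκ0]
    exact Real.le_sqrt_of_sq_le h1

end Bounds

end QuantumMeasurement

end

open QuantumMeasurement in
theorem mainTheorem6 {HS HA X : Type*}
    [NormedAddCommGroup HS] [InnerProductSpace ℂ HS] [CompleteSpace HS]
    [TopologicalSpace.SeparableSpace HS]
    [NormedAddCommGroup HA] [InnerProductSpace ℂ HA] [CompleteSpace HA]
    [TopologicalSpace.SeparableSpace HA] [Countable X]
    (M : MeasurementScheme HS HA X)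
    (E : X → (HS →L[ℂ] HS)) (hE : IsObservable E)
    (NS : HS →L[ℂ] HS) (hNS : IsSelfAdjoint NS)
    (NA : HA →L[ℂ] HA) (hNA : IsSelfAdjoint NA)
    (hWY : M.WeakYanase NS NA) :
    (∀ x, ‖⁅E x, NS⁆‖ ≤ 2 * ‖NS‖ * ‖M.error E x‖
      + 2 * √(variance NA M.ξ) * √(2 * ‖M.error E x‖ + ‖E x - E x ^ 2‖)) ∧
    (∀ x, ‖⁅E x, NS⁆‖ ≤ 2 * ‖NS‖ * ‖M.error E x‖
      + 1 / 2 * √(fisherInformation NA M.ξ)) ∧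
    (IsExtremalObservable E → M.Measures E →
      ∀ x, ‖⁅E x, NS⁆‖ ≤ √(fisherInformation NA M.ξ) * √‖E x - E x ^ 2‖) ∧
    (IsSharpObservable E → M.Measures E → ∀ x, ⁅E x, NS⁆ = 0) := by
  refine ⟨M.norm_commutator_le_variance hE hNS hNA hWY,
    M.norm_commutator_le_fisherInformation hNS hNA hWY,
    fun hext hM => M.norm_commutator_le_of_isExtremal hext hM hNS hNA hWY, fun hsharp hM x => ?_⟩
  -- Sharpness needs no extremality: the variance bound vanishes once `ε(x) = 0` and `E(x)² = E(x)`.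
  have h := M.norm_commutator_le_variance hE hNS hNA hWY x
  have h1 : M.error E x = 0 := sub_eq_zero.2 (hM x)
  have h2 : E x - E x ^ 2 = 0 := by rw [sq, hsharp.idempotent, sub_self]
  rw [h1, h2] at h
  simpa using h
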